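/- Let $\mathcal A$ be a unital C*-algebra (or, more generally, a possibly incomplete unital complex $*$-algebra with a C*-norm) with a linear functional $\varphi$, and let $\mathcal E=(\mathcal U,\tilde\varphi,(\iota_k)_{k})$ be an exchangeability system for $(\mathcal A,\varphi)$: $\mathcal U$ is a unital C*-algebra with state $\tilde\varphi$, and $\iota_k:\mathcal A\to\mathcal U$, $X\mapsto X^{(k)}$, is an infinite sequence of embeddings (isometric unital $*$-homomorphisms) with $\tilde\varphi\circ\iota_k=\varphi$ such that $$\tilde\varphi\bigl(X_1^{(h(1))}\cdots X_n^{(h(n))}\bigr)=\tilde\varphi\bigl(X_1^{(\sigma(h(1)))}\cdots X_n^{(\sigma(h(n)))}\bigr)$$ for all $n$, all $X_1,\dots,X_n\in\mathcal A$, all indices $h(1),\dots,h(n)$ and all finitely supported permutations $\sigma$ of the index set. For a partition $\pi$ of $[n]=\{1,\dots,n\}$ let $\varphi_\pi(X_1,\dots,X_n)=\tilde\varphi(X_1^{(h(1))}\cdots X_n^{(h(n))})$ for any $h$ with $h(i)=h(j)\iff i\sim_\pi j$, and let $K_\pi(X_1,\dots,X_n)=\sum_{\sigma\le\pi}\varphi_\sigma(X_1,\dots,X_n)\,\mu(\sigma,\pi)$,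 where $\mu$ is the Möbius function of the lattice of all partitions of $[n]$, ordered by refinement. Assume that 1. $\mathcal E$ is noncrossing: $K_\pi(X_1,\dots,X_n)=0$ for all $n$, all $X_1,\dots,X_n\in\mathcal A$ and every partition $\pi$ of $[n]$ that has a crossing (i.e. there are $i<j<k<l$ with $i\sim_\pi k$, $j\sim_\pi l$, $i\not\sim_\pi j$); 2. $\mathcal E$ satisfies the weak singleton condition: $\tilde\varphi(X_1^{(h(1))}\cdots X_n^{(h(n))})=0$ whenever for some $j$ the index $h(j)$ appears only once among $h(1),\dots,h(n)$ and $\tilde\varphi\bigl((X_j^{(1)})^*X_j^{(2)}\bigr)=0$; 3. $\tilde\varphi$ is faithful: $\tilde\varphi(T^*T)=0$ implies $T=0$ for $T\in\mathcal U$. Then for every selfadjoint $X\in\mathcal A$ with $\tilde\varphi(X^{(1)}X^{(2)})=0$ and every integer $N\ge 2$, $$\Bigl\|\sum_{i=1}^N X^{(i)}\Bigr\|\le\frac{2\sqrt N}{1-\frac1{\sqrt N}}\,\|X\|.$$ -/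

import Mathlib

/-- A state on a unital complex `*`-algebra: a unital linear functional that is nonnegative on
all elements `T* T`. -/
structure IsState {B : Type*} [Ring B] [StarRing B] [Algebra ℂ B] (f : B →ₗ[ℂ] ℂ) : Prop where
  map_one : f 1 = 1
  re_nonneg : ∀ T : B, 0 ≤ (f (star T * T)).re
  im_eq_zero : ∀ T : B, (f (star T * T)).im = 0

/-- An exchangeability system for the noncommutative probability space `(A, φ)`:
a C*-algebra `U` with a state, and an infinite family of state-preserving embeddings
`ι k : A → U`, `X ↦ X^{(k)}`, whose ranges are interchangeable.

`A` carries a C*-norm and may be incomplete (e.g. a dense `*`-subalgebra of a C*-algebra); an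
embedding is an isometric unital `*`-homomorphism. When `A` is a C*-algebra, every injective
`*`-homomorphism is isometric (`NonUnitalStarAlgHom.isometry`). By `state_ι`, the functional `φ`
is itself a state. -/
structure ExchangeabilitySystem {A : Type*} [NormedRing A] [StarRing A] [CStarRing A]
    [NormedAlgebra ℂ A] [StarModule ℂ A] (φ : A →ₗ[ℂ] ℂ) (U : Type*) [CStarAlgebra U] where
  /-- the state on `U` -/
  state : U →ₗ[ℂ] ℂ
  isState : IsState state
  /-- the embeddings `X ↦ X^{(k)}` -/
  ι : ℕ → (A →⋆ₐ[ℂ] U)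
  isometry_ι : ∀ k, Isometry (ι k)
  state_ι : ∀ k X, state (ι k X) = φ X
  /-- invariance of the mixed moments under finitely supported permutations of the indices -/
  exchangeable : ∀ σ : Equiv.Perm ℕ, {i | σ i ≠ i}.Finite →
    ∀ (n : ℕ) (X : Fin n → A) (h : Fin n → ℕ),
      state (List.ofFn fun j => ι (h j) (X j)).prod
        = state (List.ofFn fun j => ι (σ (h j)) (X j)).prod

namespace SetPartition

/-- Partitions of `[n]` are equivalence relations on `Fin n`, ordered by refinement (`σ ≤ π` when
`σ` is finer than `π`). A partition as a function `[n] → ℕ`, constant on each block and with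
distinct values on distinct blocks: a block is labelled by its least element. -/
noncomputable def blockIndex {n : ℕ} (π : Setoid (Fin n)) (i : Fin n) : ℕ :=
  sInf {m : ℕ | ∃ j : Fin n, (j : ℕ) = m ∧ π j i}

theorem ker_blockIndex {n : ℕ} (π : Setoid (Fin n)) : Setoid.ker (blockIndex π) = π := by
  ext i k
  rw [Setoid.ker_def]
  constructor
  · intro h
    obtain ⟨j, hj, hji⟩ := Nat.sInf_mem (s := {m : ℕ | ∃ j : Fin n, (j : ℕ) = m ∧ π j i})
      ⟨i, i, rfl, π.refl i⟩
    obtain ⟨l, hl, hlk⟩ := Nat.sInf_mem (s := {m : ℕ | ∃ j : Fin n, (j : ℕ) = m ∧ π j k})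
      ⟨k, k, rfl, π.refl k⟩
    have hjl : j = l := Fin.ext (hj.trans (h.trans hl.symm))
    subst hjl
    exact π.trans (π.symm hji) hlk
  · intro h
    have hs : {m : ℕ | ∃ j : Fin n, (j : ℕ) = m ∧ π j i}
        = {m : ℕ | ∃ j : Fin n, (j : ℕ) = m ∧ π j k} := by
      ext m
      exact ⟨fun ⟨j, hj, hji⟩ => ⟨j, hj, π.trans hji h⟩,
        fun ⟨j, hj, hjk⟩ => ⟨j, hj, π.trans hjk (π.symm h)⟩⟩
    unfold blockIndex
    rw [hs]

/-- `π` is noncrossing: there are no `i < j < k < l` with `i ∼ k`, `j ∼ l` and `i ≁ j`. -/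
def IsNoncrossing {n : ℕ} (π : Setoid (Fin n)) : Prop :=
  ¬ ∃ i j k l : Fin n, i < j ∧ j < k ∧ k < l ∧ π i k ∧ π j l ∧ ¬ π i j

noncomputable instance instFintypeSetoidFin (n : ℕ) : Fintype (Setoid (Fin n)) :=
  haveI : Finite (Setoid (Fin n)) :=
    Finite.of_injective (fun (π : Setoid (Fin n)) (i j : Fin n) => π i j)
      fun _ _ h => Setoid.ext fun i j => iff_of_eq (congrFun (congrFun h i) j)
  Fintype.ofFinite _

open scoped Classical in
noncomputable instance instLocallyFiniteOrderSetoidFin (n : ℕ) :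
    LocallyFiniteOrder (Setoid (Fin n)) :=
  Fintype.toLocallyFiniteOrder

open scoped Classical in
/-- The Möbius function `μ(σ, π)` of the lattice of all partitions of `[n]`. -/
noncomputable def moebius {n : ℕ} (σ π : Setoid (Fin n)) : ℂ :=
  IncidenceAlgebra.mu ℂ σ π

end SetPartition

namespace ExchangeabilitySystem

variable {A : Type*} [NormedRing A] [StarRing A] [CStarRing A] [NormedAlgebra ℂ A]
  [StarModule ℂ A] {φ : A →ₗ[ℂ] ℂ} {U : Type*} [CStarAlgebra U]

/-- The mixed moment of `X₁^{(h 1)} X₂^{(h 2)} ⋯ Xₙ^{(h n)}`. -/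
noncomputable def moment (E : ExchangeabilitySystem φ U) {n : ℕ} (h : Fin n → ℕ)
    (X : Fin n → A) : ℂ :=
  E.state (List.ofFn fun j => E.ι (h j) (X j)).prod

/-- The partitioned expectation `φ_π(X₁, …, Xₙ)`. -/
noncomputable def partMoment (E : ExchangeabilitySystem φ U) {n : ℕ} (π : Setoid (Fin n))
    (X : Fin n → A) : ℂ :=
  E.moment (SetPartition.blockIndex π) X

open scoped Classical in
/-- The cumulant `K_π(X₁, …, Xₙ) = ∑_{σ ≤ π} φ_σ(X₁, …, Xₙ) μ(σ, π)`. -/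
noncomputable def cumulant (E : ExchangeabilitySystem φ U) {n : ℕ} (π : Setoid (Fin n))
    (X : Fin n → A) : ℂ :=
  ∑ σ : Setoid (Fin n) with σ ≤ π, E.partMoment σ X * SetPartition.moebius σ π

/-- Crossing cumulants vanish. -/
def IsNoncrossing (E : ExchangeabilitySystem φ U) : Prop :=
  ∀ (n : ℕ) (π : Setoid (Fin n)), ¬ SetPartition.IsNoncrossing π →
    ∀ X : Fin n → A, E.cumulant π X = 0

/-- A mixed moment vanishes whenever some index `h j` occurs only once in it and the corresponding
`X j` satisfies `state ((X j)^{(1)}* (X j)^{(2)}) = 0`. -/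
def WeakSingletonCondition (E : ExchangeabilitySystem φ U) : Prop :=
  ∀ (n : ℕ) (X : Fin n → A) (h : Fin n → ℕ) (j : Fin n),
    (∀ k, h k = h j → k = j) →
    E.state (star (E.ι 1 (X j)) * E.ι 2 (X j)) = 0 →
    E.moment h X = 0

/-- The state on `U` is faithful. -/
def IsFaithful (E : ExchangeabilitySystem φ U) : Prop :=
  ∀ T : U, E.state (star T * T) = 0 → T = 0

end ExchangeabilitySystem

/-!
Only the word moments of the single element `X` matter, and they expand as `φ(X^{(w₁)} ⋯ X^{(wₙ)})
= ∑ K_τ` over the partitions `τ ≤ ker w` (`wordMoment_eq_sum`), where crossing partitions drop out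
by hypothesis and partitions with singletons drop out by the weak singleton condition. The bound is
then proved as in the free case, where `L²` is a Fock space: if `P i` is the projection onto the
vectors that start with the letter `i`, then the `P i` are mutually orthogonal and `(1 - P i)
X^{(i)} (1 - P i) = 0`. So `∑ X^{(i)}` is the sum of a block diagonal operator of norm at most
`‖X‖` and of two mixed operators of norm at most `√N ‖X‖` (`inner_sum_le_of_reducing`), which gives
the constant `1 + 2 √N ≤ 2 √N / (1 - 1 / √N)`.

The Fock space is replaced by a real pre-Hilbert space of formal words. Besides the named letters
`X^{(i)}`, words may contain dummy letters, which stand for copies of `X` with fresh indices; two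
vectors never share a dummy, so a word of dummies plays the role of an element of the tail algebra.
Averaging over many independent copies of a vector shows that the form is positive and that
multiplication by `X^{(i)}` is bounded by `‖X‖` (`pairing_nonneg`, `pairing_consMap_le`).

In the inner product of two words `u` and `v`, a noncrossing partition has nested blocks connecting
`u` with `v`, and `P i v` must single out those partitions whose innermost connecting block has
colour `i`. What lies between the junction and the first connected letter of `v` is isolated, so it
can be replaced by dummies, and `P i v` becomes an integer combination of words that has the
required effect for each noncrossing partition separately (`linearCombination_component`).
Orthogonality is the uniqueness of the innermost connecting block
(`compatForm_componentVec_componentVec`), and the vanishing corner says that a letter in the middle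
of a word which is no singleton is connected to the left or to the right
(`compatForm_sub_componentVec`).

This bounds the moments `φ(S²ⁿ)` of `S = ∑ X^{(i)}`, and faithfulness turns them into a bound on
the norm (`IsState.norm_le_of_moments`).
-/

/-! ### Words, labels and connected letters -/

namespace NoncrossingWords

/-- A list of block labels is noncrossing if no two distinct labels alternate in it as `a … b … a …
b`. -/
def IsNC (t : List ℕ) : Prop := ∀ a b, a ≠ b → ¬ [a, b, a, b].Sublist t

/-- Letters are pairs `(t, i)`: the letter `(0, i)` is *named* and stands for `X^{(i)}`, while a
letter with `t ≠ 0` is a *dummy*, a copy of `X` whose index is never shared by two different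
vectors.

The labels `tl.reverse ++ tr` of a partition are compatible with the pair of words `(u, v)` if the
partition refines the kernel of the word `u* v`, where dummies of `u` are regarded as different
from dummies of `v`: there are functions from labels to letters carrying `tl` to `u` and `tr` to
`v`, which agree and are named on the labels of blocks that meet both words. The list `tl` is read
from the junction of `u*` and `v` outwards, so that it runs parallel to `u`. -/
def Compat (tl : List ℕ) (u : List (ℕ × ℕ)) (tr : List ℕ) (v : List (ℕ × ℕ)) : Prop :=
  ∃ f g : ℕ → ℕ × ℕ, tl.map f = u ∧ tr.map g = v ∧
    ∀ l ∈ tl, l ∈ tr → f l = g l ∧ (f l).1 = 0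

/-- The word `a` with all its letters given the tag `t`; for `t = 0` it is a named word. -/
def tagged (t : ℕ) (a : List ℕ) : List (ℕ × ℕ) := a.map (Prod.mk t)

theorem Compat.symm {tl u tr v} (h : Compat tl u tr v) : Compat tr v tl u := by
  obtain ⟨f, g, hf, hg, h⟩ := h
  exact ⟨g, f, hg, hf, fun l h1 h2 => ⟨(h l h2 h1).1.symm, (h l h2 h1).1 ▸ (h l h2 h1).2⟩⟩

theorem compat_comm {tl u tr v} : Compat tl u tr v ↔ Compat tr v tl u := ⟨.symm, .symm⟩

theorem IsNC.reverse {t : List ℕ} (h : IsNC t) : IsNC t.reverse := by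
  intro a b hab hs
  refine h b a hab.symm ?_
  simpa using hs.reverse

/-- The first label of `tr` that also occurs in `tl` stands next to the letter `i` of `v`. For a
noncrossing partition this says that the innermost block connecting the two words has colour `i`.
-/
def FirstMeets (i : ℕ) (tl : List ℕ) : List ℕ → List ℕ → Prop
  | l :: tr, y :: v => (l ∈ tl ∧ y = i) ∨ (l ∉ tl ∧ FirstMeets i tl tr v)
  | _, _ => False

theorem firstMeets_iff {i : ℕ} {tl : List ℕ} {g : ℕ → ℕ × ℕ} :
    ∀ {tr v : List ℕ}, tr.map g = tagged 0 v →
      (FirstMeets i tl tr v ↔ ∃ l, tr.find? (· ∈ tl) = some l ∧ g l = (0, i)) := by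
  intro tr
  induction tr with
  | nil => intro v h; cases v <;> simp [FirstMeets]
  | cons l tr ih =>
    intro v h
    cases v with
    | nil => simp [tagged] at h
    | cons y v =>
      have h' : g l = (0, y) ∧ tr.map g = tagged 0 v := by simpa [tagged] using h
      by_cases hl : l ∈ tl
      · simp [FirstMeets, hl, h'.1]
      · simp [FirstMeets, hl, ih h'.2]

/-- In a noncrossing partition, the innermost block connecting the two sides is the same seen from
either side. -/
theorem find?_comm {tl tr : List ℕ} (hnc : IsNC (tl.reverse ++ tr)) {l : ℕ}
    (h : tr.find? (· ∈ tl) = some l) : tl.find? (· ∈ tr) = some l := by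
  rw [List.find?_eq_some_iff_append] at h
  obtain ⟨hl, a, b, rfl, ha⟩ := h
  simp only [decide_eq_true_eq] at hl
  obtain ⟨c, d, rfl, hc⟩ := List.eq_append_cons_of_mem hl
  rw [List.find?_eq_some_iff_append]
  refine ⟨by simp, c, d, rfl, fun x hx => ?_⟩
  have hxl : x ≠ l := fun h => hc (h ▸ hx)
  have hxa : x ∉ a := fun h => by simpa [hx] using ha x h
  suffices x ∉ b by simp [hxl, hxa, this]
  intro hxb
  refine hnc l x hxl.symm ?_
  have h1 : [l, x].Sublist (c ++ l :: d).reverse := by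
    have : [x, l].Sublist (c ++ l :: d) :=
      (List.singleton_sublist.2 hx).append
        (List.singleton_sublist.2 (by simp) : [l].Sublist (l :: d))
    simpa using this.reverse
  have h2 : [l, x].Sublist (a ++ l :: b) :=
    ((List.singleton_sublist.2 hxb).cons_cons l).trans (List.sublist_append_right _ _)
  exact h1.append h2

/-- The colour of the innermost connecting block is unique and is the same seen from either side.
-/
theorem firstMeets_comm {tl tr : List ℕ} (hnc : IsNC (tl.reverse ++ tr)) {u v : List ℕ}
    (h : Compat tl (tagged 0 u) tr (tagged 0 v)) {i j : ℕ} :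
    FirstMeets i tr tl u ∧ FirstMeets j tl tr v ↔ i = j ∧ FirstMeets j tl tr v := by
  obtain ⟨f, g, hf, hg, h⟩ := h
  rw [firstMeets_iff hf, firstMeets_iff hg]
  constructor
  · rintro ⟨⟨l, hl, hfl⟩, l', hl', hgl⟩
    have := find?_comm hnc hl'
    obtain rfl : l = l' := by simpa [hl] using this
    have hm : l ∈ tl := List.mem_of_find?_eq_some hl
    have hm' : l ∈ tr := List.mem_of_find?_eq_some hl'
    have := (h l hm hm').1
    rw [hfl, hgl] at this
    exact ⟨by simpa using this, l, hl', hgl⟩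
  · rintro ⟨rfl, l, hl', hgl⟩
    have hl := find?_comm hnc hl'
    have hm : l ∈ tl := List.mem_of_find?_eq_some hl
    have hm' : l ∈ tr := List.mem_of_find?_eq_some hl'
    exact ⟨⟨l, hl, (h l hm hm').1.trans hgl⟩, l, hl', hgl⟩

theorem mem_tagged {t : ℕ} {a : List ℕ} {x : ℕ × ℕ} (h : x ∈ tagged t a) : x.1 = t := by
  obtain ⟨y, -, rfl⟩ := List.mem_map.1 h
  rfl

theorem map_append₃ {lp la lw : List ℕ} {p a w : List (ℕ × ℕ)} {g : ℕ → ℕ × ℕ}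
    (hp : lp.length = p.length) (ha : la.length = a.length)
    (h : (lp ++ (la ++ lw)).map g = p ++ (a ++ w)) :
    lp.map g = p ∧ la.map g = a ∧ lw.map g = w := by
  rw [List.map_append, List.map_append] at h
  obtain ⟨h1, h2⟩ := List.append_inj h (by simpa using hp)
  exact ⟨h1, List.append_inj h2 (by simpa using ha)⟩

/-- The tag of a segment whose blocks are isolated from everything else may be changed freely. -/
theorem Compat.retag {tl lp la lw : List ℕ} {u p w : List (ℕ × ℕ)} {a : List ℕ} {t t' : ℕ}
    (hp : lp.length = p.length) (ha : la.length = a.length)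
    (h1 : ∀ l ∈ la, l ∉ tl) (h2 : ∀ l ∈ la, l ∉ lp) (h3 : ∀ l ∈ la, l ∉ lw)
    (h : Compat tl u (lp ++ (la ++ lw)) (p ++ (tagged t a ++ w))) :
    Compat tl u (lp ++ (la ++ lw)) (p ++ (tagged t' a ++ w)) := by
  obtain ⟨f, g, hf, hg, h⟩ := h
  obtain ⟨hgp, hga, hgw⟩ := map_append₃ hp (by simpa [tagged] using ha) hg
  refine ⟨f, fun l => if l ∈ la then (t', (g l).2) else g l, hf, ?_, fun l hl hl' => ?_⟩
  · rw [List.map_append, List.map_append]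
    congr 1
    · rw [← hgp]
      exact List.map_congr_left fun l hl => if_neg fun hla => h2 l hla hl
    congr 1
    · have : la.map (fun l => if l ∈ la then (t', (g l).2) else g l)
          = (la.map g).map fun x => (t', x.2) := by
        rw [List.map_map]
        exact List.map_congr_left fun l hl => if_pos hl
      rw [this, hga]
      simp [tagged]
    · rw [← hgw]
      exact List.map_congr_left fun l hl => if_neg fun hla => h3 l hla hl
  · have : l ∉ la := fun hla => h1 l hla hl
    simpa [this] using h l hl hl'

/-- Replacing a segment of named letters by fresh dummies amounts to the condition that its blocks
meet neither the left word nor the rest of the right word. -/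
theorem compat_tagged_iff {tl lp la lw : List ℕ} {u p : List (ℕ × ℕ)} {a w : List ℕ} {t : ℕ}
    (ht : 0 < t) (hp : lp.length = p.length) (ha : la.length = a.length)
    (htp : ∀ x ∈ p, t < x.1) :
    Compat tl u (lp ++ (la ++ lw)) (p ++ (tagged t a ++ tagged 0 w)) ↔
      Compat tl u (lp ++ (la ++ lw)) (p ++ (tagged 0 a ++ tagged 0 w)) ∧
        (∀ l ∈ la, l ∉ tl) ∧ ∀ l ∈ la, l ∉ lw := by
  have key : ∀ {t' : ℕ} {g : ℕ → ℕ × ℕ}, t' ≤ t →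
      (lp ++ (la ++ lw)).map g = p ++ (tagged t' a ++ tagged 0 w) →
      (∀ l ∈ lp, t < (g l).1) ∧ (∀ l ∈ la, (g l).1 = t') ∧ ∀ l ∈ lw, (g l).1 = 0 := by
    intro t' g _ hg
    obtain ⟨hgp, hga, hgw⟩ := map_append₃ hp (by simpa [tagged] using ha) hg
    exact ⟨fun l hl => htp _ (hgp ▸ List.mem_map_of_mem hl),
      fun l hl => mem_tagged (hga ▸ List.mem_map_of_mem hl),
      fun l hl => mem_tagged (hgw ▸ List.mem_map_of_mem hl)⟩
  constructor
  · intro h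
    have h' := h
    obtain ⟨f, g, hf, hg, hc⟩ := h'
    obtain ⟨k1, k2, k3⟩ := key le_rfl hg
    have d1 : ∀ l ∈ la, l ∉ tl := fun l hl hl' => by
      have := hc l hl' (by simp [hl])
      have := k2 l hl
      grind
    have d3 : ∀ l ∈ la, l ∉ lw := fun l hl hl' => by
      have := k2 l hl
      have := k3 l hl'
      omega
    exact ⟨h.retag hp ha d1 (fun l hl hl' => by
      have := k2 l hl
      have := k1 l hl'
      omega) d3, d1, d3⟩
  · rintro ⟨h, d1, d3⟩
    have h' := h
    obtain ⟨f, g, hf, hg, hc⟩ := h'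
    obtain ⟨k1, k2, k3⟩ := key (Nat.zero_le _) hg
    exact h.retag hp ha d1 (fun l hl hl' => by
      have := k2 l hl
      have := k1 l hl'
      omega) d3

open Finsupp in
/-- A combination of words that represents the part of the word `a ++ w` in which no letter of `a`
is connected to the vector it is paired with. The recursion runs over the first letter `y` of `w`
that is connected: the part of `y :: w` in which `y` is connected is `y :: w` minus `detach [y] w`,
and everything before `y` is then isolated by noncrossingness, so it is replaced by dummies. The
tag is one more than the number of remaining letters: it is never `0`, and it decreases along the
recursion, which keeps nested groups of dummies apart. -/
noncomputable def detach : List ℕ → List ℕ → (List (ℕ × ℕ) →₀ ℝ)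
  | a, [] => single (tagged 1 a) 1
  | a, y :: w =>
      mapDomain (tagged (w.length + 2) a ++ ·) (single (tagged 0 (y :: w)) 1 - detach [y] w)
        + detach (a ++ [y]) w

open Finsupp in
/-- The part of the word `a ++ w` in which no letter of `a` is connected to the vector it is paired
with and the first connected letter of `w` is `i`. -/
noncomputable def component (i : ℕ) : List ℕ → List ℕ → (List (ℕ × ℕ) →₀ ℝ)
  | _, [] => 0
  | a, y :: w =>
      (if y = i then mapDomain (tagged (w.length + 2) a ++ ·)
          (single (tagged 0 (y :: w)) 1 - detach [y] w) else 0)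
        + component i (a ++ [y]) w

open scoped Classical in
/-- The indicator of `Compat`. -/
noncomputable def compatInd (tl : List ℕ) (u : List (ℕ × ℕ)) (tr : List ℕ) (v : List (ℕ × ℕ)) : ℝ :=
  if Compat tl u tr v then 1 else 0

/-- A segment between two connected positions which does not meet the left side is isolated. -/
theorem not_mem_of_isNC {tl lp la lw : List ℕ} {l : ℕ}
    (hnc : IsNC (tl.reverse ++ (lp ++ (la ++ l :: lw)))) (hl : l ∈ tl) (hla : ∀ m ∈ la, m ∉ tl) :
    ∀ m ∈ la, m ∉ l :: lw := by
  intro m hm hm'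
  have hml : m ≠ l := fun h => hla m hm (h ▸ hl)
  have hmw : m ∈ lw := by simpa [hml] using hm'
  refine hnc l m hml.symm ?_
  have h1 : [l].Sublist tl.reverse := List.singleton_sublist.2 (by simpa using hl)
  have h2 : [m].Sublist la := List.singleton_sublist.2 hm
  have h3 : [l, m].Sublist (l :: lw) := (List.singleton_sublist.2 hmw).cons_cons l
  exact h1.append ((h2.append h3).trans (List.sublist_append_right _ _))

open Finsupp in
open scoped Classical in
/-- The part of a word in which a given letter is connected to the left word, in terms of the part
in which it is not. -/
theorem linearCombination_connected {tl : List ℕ} {u : List (ℕ × ℕ)} {w lw a la : List ℕ}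
    {p : List (ℕ × ℕ)} {lp : List ℕ} {y l : ℕ}
    (hp : lp.length = p.length) (ha : la.length = a.length)
    (htp : ∀ x ∈ p, w.length + 2 < x.1)
    (hnc : IsNC (tl.reverse ++ (lp ++ (la ++ l :: lw))))
    (hd : linearCombination ℝ (fun v => compatInd tl u ((lp ++ la) ++ ([l] ++ lw))
        ((p ++ tagged (w.length + 2) a) ++ v)) (detach [y] w)
      = if Compat tl u ((lp ++ la) ++ ([l] ++ lw))
          ((p ++ tagged (w.length + 2) a) ++ (tagged 0 [y] ++ tagged 0 w)) ∧ ∀ m ∈ [l], m ∉ tl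
        then 1 else 0) :
    linearCombination ℝ (fun v => compatInd tl u (lp ++ (la ++ l :: lw)) (p ++ v))
        (mapDomain (tagged (w.length + 2) a ++ ·) (single (tagged 0 (y :: w)) 1 - detach [y] w))
      = if Compat tl u (lp ++ (la ++ l :: lw)) (p ++ (tagged 0 a ++ tagged 0 (y :: w))) ∧
          (∀ m ∈ la, m ∉ tl) ∧ l ∈ tl then 1 else 0 := by
  rw [linearCombination_mapDomain, map_sub, linearCombination_single]
  simp only [List.append_assoc, List.singleton_append, Function.comp_def] at hd ⊢
  rw [hd]
  have e : tagged 0 [y] ++ tagged 0 w = tagged 0 (y :: w) := rfl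
  rw [e]
  have key := compat_tagged_iff (tl := tl) (lw := l :: lw) (w := y :: w) (u := u)
    (t := w.length + 2) (by omega) hp ha htp
  have hdis := fun h1 h2 => not_mem_of_isNC (l := l) hnc h1 h2
  simp only [compatInd, key]
  by_cases h0 : Compat tl u (lp ++ (la ++ l :: lw)) (p ++ (tagged 0 a ++ tagged 0 (y :: w)))
  · by_cases h1 : l ∈ tl
    · by_cases h2 : ∀ m ∈ la, m ∉ tl
      · rw [if_pos ⟨h0, h2, hdis h1 h2⟩, if_neg (by simp [h1]), if_pos ⟨h0, h2, h1⟩]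
        simp
      · simp [h2]
    · simp [h0, h1]
  · simp [h0]

open Finsupp in
open scoped Classical in
/-- The combination `detach a w` does what it is meant to do, separately for every noncrossing
partition and even after an arbitrary prefix of dummies with large tags. -/
theorem linearCombination_detach {tl : List ℕ} {u : List (ℕ × ℕ)} :
    ∀ (w lw a la : List ℕ) (p : List (ℕ × ℕ)) (lp : List ℕ),
      lw.length = w.length → lp.length = p.length → la.length = a.length →
      (∀ x ∈ p, w.length + 1 < x.1) → IsNC (tl.reverse ++ (lp ++ (la ++ lw))) →
      linearCombination ℝ (fun v => compatInd tl u (lp ++ (la ++ lw)) (p ++ v)) (detach a w)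
        = if Compat tl u (lp ++ (la ++ lw)) (p ++ (tagged 0 a ++ tagged 0 w)) ∧ ∀ l ∈ la, l ∉ tl
          then 1 else 0 := by
  intro w
  induction w with
  | nil =>
    intro lw a la p lp hw hp ha htp hnc
    obtain rfl : lw = [] := by simpa using hw
    have key := compat_tagged_iff (tl := tl) (lw := []) (w := []) (u := u) (t := 1)
      (by omega) hp ha (by simpa using htp)
    have e : tagged 0 [] = [] := rfl
    rw [e, List.append_nil, List.append_nil, List.append_nil] at key
    rw [detach, linearCombination_single, List.append_nil, e, List.append_nil]
    simp [compatInd, key]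
  | cons y w ih =>
    intro lw a la p lp hw hp ha htp hnc
    obtain ⟨l, lw, rfl⟩ : ∃ l lw', lw = l :: lw' := by
      cases lw with
      | nil => simp at hw
      | cons l lw => exact ⟨l, lw, rfl⟩
    have hw' : lw.length = w.length := by simpa using hw
    have htp' : ∀ x ∈ p, w.length + 2 < x.1 := by simpa [add_assoc] using htp
    rw [detach, map_add, linearCombination_connected hp ha htp' hnc (ih lw [y] [l] _ _ hw'
      (by simp [hp, ha, tagged]) rfl ?_ (by simpa using hnc))]
    · have h2 := ih lw (a ++ [y]) (la ++ [l]) p lp hw' hp (by simp [ha])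
        (fun x hx => by have := htp' x hx; omega) (by simpa using hnc)
      simp only [List.append_assoc, List.singleton_append, tagged, List.map_append,
        List.map_cons, List.map_nil] at h2 ⊢
      rw [h2]
      by_cases h1 : l ∈ tl
      · simp [h1, or_imp, forall_and]
      · simp [h1, or_imp, forall_and]
    · intro x hx
      rcases List.mem_append.1 hx with hx | hx
      · have := htp' x hx
        omega
      · have := mem_tagged hx
        omega

open Finsupp in
open scoped Classical in
theorem linearCombination_component_aux {tl : List ℕ} {u : List (ℕ × ℕ)} {i : ℕ} :
    ∀ (w lw a la : List ℕ),
      lw.length = w.length → la.length = a.length → IsNC (tl.reverse ++ (la ++ lw)) →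
      linearCombination ℝ (fun v => compatInd tl u (la ++ lw) v) (component i a w)
        = if Compat tl u (la ++ lw) (tagged 0 a ++ tagged 0 w) ∧ (∀ l ∈ la, l ∉ tl) ∧
            FirstMeets i tl lw w then 1 else 0 := by
  intro w
  induction w with
  | nil =>
    intro lw a la hw ha hnc
    simp [component, FirstMeets]
  | cons y w ih =>
    intro lw a la hw ha hnc
    obtain ⟨l, lw, rfl⟩ : ∃ l lw', lw = l :: lw' := by
      cases lw with
      | nil => simp at hw
      | cons l lw => exact ⟨l, lw, rfl⟩
    have hw' : lw.length = w.length := by simpa using hw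
    have h1 := linearCombination_connected (tl := tl) (u := u) (p := []) (lp := []) (y := y)
      (w := w) (l := l) (lw := lw) rfl ha (by simp) (by simpa using hnc)
      (linearCombination_detach w lw [y] [l] _ _ hw'
        (by simp [ha, tagged]) rfl
        (fun x hx => by have := mem_tagged (by simpa using hx); omega) (by simpa using hnc))
    have h2 := ih lw (a ++ [y]) (la ++ [l]) hw' (by simp [ha]) (by simpa using hnc)
    simp only [List.append_assoc, List.singleton_append, tagged, List.map_append,
      List.map_cons, List.map_nil, List.nil_append] at h1 h2 ⊢
    rw [component, map_add, h2, apply_ite (linearCombination ℝ _), map_zero]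
    simp only [tagged, List.map_cons]
    rw [h1]
    by_cases hl : l ∈ tl
    · by_cases hy : y = i <;> simp [hl, hy, FirstMeets, or_imp, forall_and]
    · simp [hl, FirstMeets, or_imp, forall_and]

open Finsupp in
open scoped Classical in
theorem linearCombination_component {tl tr : List ℕ} (hnc : IsNC (tl.reverse ++ tr))
    (u : List (ℕ × ℕ)) {v : List ℕ} (hv : tr.length = v.length) (i : ℕ) :
    linearCombination ℝ (fun v' => compatInd tl u tr v') (component i [] v)
      = if FirstMeets i tl tr v then compatInd tl u tr (tagged 0 v) else 0 := by
  have := linearCombination_component_aux (u := u) (i := i) v tr [] [] hv rfl hnc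
  simp only [List.nil_append] at this
  rw [this]
  by_cases h : FirstMeets i tl tr v
  · simp only [h, compatInd, tagged, List.map_nil, List.nil_append, and_true, if_true,
      List.not_mem_nil, false_imp_iff, implies_true]
    congr
  · simp [h]

end NoncrossingWords

/-! ### Components as vectors -/

namespace NoncrossingWords
open Finsupp

/-- Real combinations of words in named and dummy letters. -/
abbrev WordSpace := List (ℕ × ℕ) →₀ ℝ

/-- The bilinear extension of `compatInd`. -/
noncomputable def compatForm (tl tr : List ℕ) : WordSpace →ₗ[ℝ] WordSpace →ₗ[ℝ] ℝ :=
  linearCombination ℝ fun u => linearCombination ℝ fun v => compatInd tl u tr v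

@[simp] theorem compatForm_single (tl tr : List ℕ) (u v : List (ℕ × ℕ)) :
    compatForm tl tr (single u 1) (single v 1) = compatInd tl u tr v := by
  simp [compatForm]

theorem bilin_ext {α β M : Type*} [AddCommGroup M] [Module ℝ M]
    {B B' : (α →₀ ℝ) →ₗ[ℝ] (β →₀ ℝ) →ₗ[ℝ] M}
    (h : ∀ u v, B (single u 1) (single v 1) = B' (single u 1) (single v 1)) : B = B' := by
  refine Finsupp.lhom_ext' fun u => LinearMap.ext_ring ?_
  refine Finsupp.lhom_ext' fun v => LinearMap.ext_ring ?_
  exact h u v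

open scoped Classical in
theorem compatForm_comm (tl tr : List ℕ) (x y : WordSpace) :
    compatForm tl tr x y = compatForm tr tl y x := by
  have : compatForm tl tr = (compatForm tr tl).flip :=
    bilin_ext fun u v => by
      simpa [compatInd] using if_congr compat_comm rfl rfl
  rw [this, LinearMap.flip_apply]

/-- A named word as a vector. -/
noncomputable def namedVec (v : List ℕ) : WordSpace := single (tagged 0 v) 1

/-- The part of a named word `v` in which the innermost block connecting it with the vector it is
paired with has colour `i`. -/
noncomputable def componentVec (i : ℕ) (v : List ℕ) : WordSpace := component i [] v

open scoped Classical in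
theorem compatForm_componentVec {tl tr : List ℕ} (hnc : IsNC (tl.reverse ++ tr)) {v : List ℕ}
    (hv : tr.length = v.length) (i : ℕ) (x : WordSpace) :
    compatForm tl tr x (componentVec i v)
      = if FirstMeets i tl tr v then compatForm tl tr x (namedVec v) else 0 := by
  have key : (compatForm tl tr).flip (componentVec i v)
      = if FirstMeets i tl tr v then (compatForm tl tr).flip (namedVec v) else 0 := by
    refine Finsupp.lhom_ext' fun u => LinearMap.ext_ring ?_
    have := linearCombination_component hnc u hv i
    have e : compatForm tl tr (single u 1) (componentVec i v)
      = linearCombination ℝ (fun v' => compatInd tl u tr v') (component i [] v) := by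
      simp [compatForm, componentVec]
    simp only [LinearMap.comp_apply, LinearMap.flip_apply, lsingle_apply]
    rw [e, this]
    split_ifs <;> simp [namedVec]
  have := congrArg (fun f => f x) key
  simp only [LinearMap.flip_apply] at this
  rw [this]
  split_ifs <;> simp

theorem isNC_swap {tl tr : List ℕ} (h : IsNC (tl.reverse ++ tr)) : IsNC (tr.reverse ++ tl) := by
  simpa using h.reverse

open scoped Classical in
theorem compatForm_componentVec_left {tl tr : List ℕ} (hnc : IsNC (tl.reverse ++ tr)) {u : List ℕ}
    (hu : tl.length = u.length) (i : ℕ) (y : WordSpace) :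
    compatForm tl tr (componentVec i u) y
      = if FirstMeets i tr tl u then compatForm tl tr (namedVec u) y else 0 := by
  rw [compatForm_comm, compatForm_componentVec (isNC_swap hnc) hu, compatForm_comm]

theorem compatForm_componentVec_componentVec {tl tr : List ℕ} (hnc : IsNC (tl.reverse ++ tr))
    {u v : List ℕ} (hu : tl.length = u.length) (hv : tr.length = v.length) (i j : ℕ) :
    compatForm tl tr (componentVec i u) (componentVec j v)
      = if i = j then compatForm tl tr (namedVec u) (componentVec j v) else 0 := by
  classical
  rw [compatForm_componentVec_left hnc hu, compatForm_componentVec hnc hv]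
  simp only [namedVec, compatForm_single, compatInd]
  by_cases h : Compat tl (tagged 0 u) tr (tagged 0 v)
  · have := firstMeets_comm hnc h (i := i) (j := j)
    simp only [h]
    grind
  · simp [h]

theorem compatForm_componentVec_namedVec {tl tr : List ℕ} (hnc : IsNC (tl.reverse ++ tr))
    {u v : List ℕ} (hu : tl.length = u.length) (hv : tr.length = v.length) (i : ℕ) :
    compatForm tl tr (componentVec i u) (namedVec v)
      = compatForm tl tr (namedVec u) (componentVec i v) := by
  classical
  rw [compatForm_componentVec_left hnc hu, compatForm_componentVec hnc hv]
  simp only [namedVec, compatForm_single, compatInd]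
  by_cases h : Compat tl (tagged 0 u) tr (tagged 0 v)
  · have h1 := firstMeets_comm hnc h (i := i) (j := i)
    have h2 := firstMeets_comm (isNC_swap hnc) h.symm (i := i) (j := i)
    simp only [h]
    grind
  · simp [h]

/-- Left multiplication by the named letter `i`. -/
noncomputable def consMap (i : ℕ) : WordSpace →ₗ[ℝ] WordSpace := lmapDomain ℝ ℝ ((0, i) :: ·)

theorem compat_cons {tl tr : List ℕ} {u v : List (ℕ × ℕ)} {l i : ℕ} :
    Compat tl u (l :: tr) ((0, i) :: v) ↔ Compat (l :: tl) ((0, i) :: u) tr v := by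
  have key : ∀ {tl tr : List ℕ} {u v : List (ℕ × ℕ)},
      Compat tl u (l :: tr) ((0, i) :: v) → Compat (l :: tl) ((0, i) :: u) tr v := by
    rintro tl tr u v ⟨f, g, hf, hg, h⟩
    simp only [List.map_cons, List.cons.injEq] at hg
    have hfe : ∀ m ∈ tl, Function.update f l (0, i) m = f m := by
      intro m hm
      by_cases hml : m = l
      · subst hml
        simp [(h m hm (by simp)).1, hg.1]
      · simp [hml]
    refine ⟨Function.update f l (0, i), g, ?_, hg.2, ?_⟩
    · rw [List.map_cons, List.map_congr_left hfe, hf]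
      simp
    · intro m hm hm'
      by_cases hml : m = l
      · subst hml
        simp [hg.1]
      · have hm : m ∈ tl := by simpa [hml] using hm
        rw [hfe m hm]
        exact h m hm (by simp [hm'])
  exact ⟨key, fun h => (key h.symm).symm⟩

open scoped Classical in
theorem compatForm_consMap (tl tr : List ℕ) (l i : ℕ) (x y : WordSpace) :
    compatForm tl (l :: tr) x (consMap i y) = compatForm (l :: tl) tr (consMap i x) y := by
  have : (compatForm tl (l :: tr)).compl₂ (consMap i)
      = (compatForm (l :: tl) tr).comp (consMap i) :=
    bilin_ext fun u v => by
      simpa [consMap, LinearMap.compl₂_apply, mapDomain_single, compatInd] using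
        if_congr compat_cons rfl rfl
  exact congrArg (fun B => B x y) this

/-- If the block of the middle letter `i` is not a singleton, then it connects that letter to the
left or to the right, and it is the innermost connecting block on that side. Hence the parts of
both words whose innermost colour is not `i` contribute nothing. -/
theorem compatForm_sub_componentVec {tl tr : List ℕ} {l : ℕ} (hnc : IsNC (tl.reverse ++ l :: tr))
    (hl : l ∈ tl ∨ l ∈ tr) {u v : List ℕ} (hu : tl.length = u.length) (hv : tr.length = v.length)
    (i : ℕ) :
    compatForm tl (l :: tr) (namedVec u - componentVec i u)
      (consMap i (namedVec v - componentVec i v)) = 0 := by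
  classical
  have hnc' : IsNC ((l :: tl).reverse ++ tr) := by simpa using hnc
  rw [map_sub (consMap i), map_sub, map_sub, LinearMap.sub_apply, LinearMap.sub_apply,
    compatForm_componentVec_left hnc hu, compatForm_componentVec_left hnc hu,
    compatForm_consMap _ _ _ _ _ (componentVec i v), compatForm_componentVec hnc' hv,
    ← compatForm_consMap]
  have e : compatForm tl (l :: tr) (namedVec u) (consMap i (namedVec v))
      = compatInd tl (tagged 0 u) (l :: tr) ((0, i) :: tagged 0 v) := by
    simp [namedVec, consMap, mapDomain_single]
  rw [e, compatInd]
  by_cases h : Compat tl (tagged 0 u) (l :: tr) ((0, i) :: tagged 0 v)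
  · obtain ⟨f, g, hf, hg, hc⟩ := h
    simp only [List.map_cons, List.cons.injEq] at hg
    rcases hl with hl | hl
    · have : FirstMeets i (l :: tr) tl u := by
        rw [firstMeets_iff hf]
        exact ⟨l, find?_comm hnc (by simp [hl]), (hc l hl (by simp)).1.trans hg.1⟩
      simp [this]
    · have : FirstMeets i (l :: tl) tr v := by
        rw [firstMeets_iff hg.2]
        exact ⟨l, find?_comm (isNC_swap hnc') (by simp [hl]), hg.1⟩
      simp [this]
  · simp [h]

theorem mapDomain_append_mem_supported {p : List (ℕ × ℕ)} {m n : ℕ} {x : WordSpace}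
    (hx : x ∈ supported ℝ ℝ {v : List (ℕ × ℕ) | v.length = n}) (hm : p.length + n = m) :
    mapDomain (p ++ ·) x ∈ supported ℝ ℝ {v : List (ℕ × ℕ) | v.length = m} := by
  refine supported_comap_lmapDomain ℝ ℝ (p ++ ·) {v : List (ℕ × ℕ) | v.length = m}
    (supported_mono (fun v hv => ?_) hx)
  simp only [Set.mem_ofPred_eq, Set.mem_preimage, List.length_append] at hv ⊢
  omega

theorem detach_mem_supported : ∀ (w a : List ℕ) {m : ℕ}, a.length + w.length = m →
    detach a w ∈ supported ℝ ℝ {v : List (ℕ × ℕ) | v.length = m} := by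
  intro w
  induction w with
  | nil =>
    intro a m hm
    exact single_mem_supported ℝ _ (by simpa [tagged] using hm)
  | cons y w ih =>
    intro a m hm
    have hm' : a.length + (w.length + 1) = m := by simpa using hm
    refine Submodule.add_mem _ (mapDomain_append_mem_supported (n := w.length + 1) ?_ ?_)
      (ih _ (by simp; omega))
    · exact Submodule.sub_mem _ (single_mem_supported ℝ _ (by simp [tagged]))
        (ih _ (by simp; omega))
    · simpa [tagged] using hm'

theorem component_mem_supported (i : ℕ) : ∀ (w a : List ℕ) {m : ℕ}, a.length + w.length = m →
    component i a w ∈ supported ℝ ℝ {v : List (ℕ × ℕ) | v.length = m} := by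
  intro w
  induction w with
  | nil =>
    intro a m hm
    exact Submodule.zero_mem _
  | cons y w ih =>
    intro a m hm
    have hm' : a.length + (w.length + 1) = m := by simpa using hm
    refine Submodule.add_mem _ ?_ (ih _ (by simp; omega))
    split_ifs
    · refine mapDomain_append_mem_supported (n := w.length + 1) ?_ (by simpa [tagged] using hm')
      exact Submodule.sub_mem _ (single_mem_supported ℝ _ (by simp [tagged]))
        (detach_mem_supported _ _ (by simp; omega))
    · exact Submodule.zero_mem _

theorem componentVec_mem_supported (i : ℕ) (v : List ℕ) :
    componentVec i v ∈ supported ℝ ℝ {w : List (ℕ × ℕ) | w.length = v.length} :=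
  component_mem_supported i v [] (by simp)

theorem namedVec_mem_supported (v : List ℕ) :
    namedVec v ∈ supported ℝ ℝ {w : List (ℕ × ℕ) | w.length = v.length} :=
  single_mem_supported ℝ _ (by simp [tagged])

theorem consMap_mem_supported (i : ℕ) {x : WordSpace} {n : ℕ}
    (hx : x ∈ supported ℝ ℝ {v : List (ℕ × ℕ) | v.length = n}) :
    consMap i x ∈ supported ℝ ℝ {v : List (ℕ × ℕ) | v.length = n + 1} :=
  mapDomain_append_mem_supported (p := [(0, i)]) hx (by simp [add_comm])

theorem bilin_eqOn_supported {α β : Type*} {B B' : (α →₀ ℝ) →ₗ[ℝ] (β →₀ ℝ) →ₗ[ℝ] ℝ}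
    {s : Set α} {t : Set β}
    (h : ∀ u ∈ s, ∀ v ∈ t, B (single u 1) (single v 1) = B' (single u 1) (single v 1))
    {x : α →₀ ℝ} {y : β →₀ ℝ} (hx : x ∈ supported ℝ ℝ s) (hy : y ∈ supported ℝ ℝ t) :
    B x y = B' x y := by
  rw [supported_eq_span_single] at hx hy
  induction hx using Submodule.span_induction with
  | mem x hx =>
    obtain ⟨u, hu, rfl⟩ := hx
    induction hy using Submodule.span_induction with
    | mem y hy =>
      obtain ⟨v, hv, rfl⟩ := hy
      exact h u hu v hv
    | zero => simp
    | add y z _ _ h1 h2 => simp [h1, h2]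
    | smul c y _ h1 => simp [h1]
  | zero => simp
  | add y z _ _ h1 h2 => simp [h1, h2]
  | smul c y _ h1 => simp [h1]

end NoncrossingWords

/-! ### Moments and cumulants -/

theorem Setoid.exists_perm_of_ker_eq {n : ℕ} {h h' : Fin n → ℕ}
    (hk : Setoid.ker h = Setoid.ker h') :
    ∃ σ : Equiv.Perm ℕ, {i | σ i ≠ i}.Finite ∧ ∀ j, σ (h j) = h' j := by
  classical
  obtain ⟨M, hM⟩ : ∃ M, ∀ j, h j < M ∧ h' j < M :=
    ⟨∑ j, (h j + h' j) + 1, fun j => by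
      have := Finset.single_le_sum (f := fun j => h j + h' j) (fun _ _ => Nat.zero_le _)
        (Finset.mem_univ j)
      grind⟩
  let a : Fin n → Fin M := fun j => ⟨h j, (hM j).1⟩
  let b : Fin n → Fin M := fun j => ⟨h' j, (hM j).2⟩
  have hab : ∀ i j, a i = a j ↔ b i = b j := fun i j => by
    have := congrArg (fun s => s i j) hk
    simpa [a, b, Setoid.ker_def] using this
  let e : {x // x ∈ Set.range a} ≃ {x // x ∈ Set.range b} :=
    (Setoid.quotientKerEquivRange a).symm.trans
      ((Quotient.congrRight fun i j => by simpa [Setoid.ker_def] using hab i j).trans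
        (Setoid.quotientKerEquivRange b))
  have he : ∀ j, (e ⟨a j, j, rfl⟩ : Fin M) = b j := fun j => by
    have : (Setoid.quotientKerEquivRange a).symm ⟨a j, j, rfl⟩ = Quotient.mk _ j := by
      rw [Equiv.symm_apply_eq]
      rfl
    simp only [e, Equiv.trans_apply, this]
    rfl
  refine ⟨e.extendSubtype.extendDomain Fin.equivSubtype,
    (Set.finite_lt_nat M).subset fun i hi => ?_, fun j => ?_⟩
  · by_contra hlt
    exact hi (Equiv.Perm.extendDomain_apply_not_subtype _ _ hlt)
  · have h1 := Equiv.Perm.extendDomain_apply_image e.extendSubtype Fin.equivSubtype (a j)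
    rw [Equiv.extendSubtype_apply_of_mem e (a j) ⟨j, rfl⟩, he] at h1
    exact h1

namespace SetPartition

/-- The blocks of a partition as a list of labels. -/
noncomputable def labels {n : ℕ} (τ : Setoid (Fin n)) : List ℕ := List.ofFn (blockIndex τ)

theorem blockIndex_eq_iff {n : ℕ} (τ : Setoid (Fin n)) {i j : Fin n} :
    blockIndex τ i = blockIndex τ j ↔ τ i j := by
  conv_rhs => rw [← ker_blockIndex τ]
  rw [Setoid.ker_def]

@[simp] theorem length_labels {n : ℕ} (τ : Setoid (Fin n)) : (labels τ).length = n := by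
  simp [labels]

theorem le_ker_iff_exists_map {β : Type*} [Nonempty β] (w : List β) (τ : Setoid (Fin w.length)) :
    τ ≤ Setoid.ker w.get ↔ ∃ F : ℕ → β, (labels τ).map F = w := by
  constructor
  · intro h
    have hf : Function.FactorsThrough w.get (blockIndex τ) := fun i j hij =>
      Setoid.ker_def.1 (h ((blockIndex_eq_iff τ).1 hij))
    refine ⟨Function.extend (blockIndex τ) w.get fun _ => Classical.arbitrary β, ?_⟩
    rw [labels, List.map_ofFn]
    conv_rhs => rw [← List.ofFn_get w]
    congr 1
    funext j
    exact hf.extend_apply _ j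
  · rintro ⟨F, hF⟩ i j hij
    have key : ∀ i : Fin w.length, w.get i = F (blockIndex τ i) := fun i => by
      have : w[(i : ℕ)]? = some (F (blockIndex τ i)) := by
        have := congrArg (fun v : List β => v[(i : ℕ)]?) hF
        simpa [labels] using this.symm
      simpa using this
    rw [Setoid.ker_def, key, key, (blockIndex_eq_iff τ).2 hij]

theorem IsNoncrossing.isNC_labels {n : ℕ} {τ : Setoid (Fin n)} (h : IsNoncrossing τ) :
    NoncrossingWords.IsNC (labels τ) := by
  intro a b hab hs
  rw [List.sublist_iff_exists_fin_orderEmbedding_get_eq] at hs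
  obtain ⟨f, hf⟩ := hs
  let g : Fin 4 → Fin n := fun k => Fin.cast (length_labels τ) (f k)
  have hg : ∀ k, blockIndex τ (g k) = [a, b, a, b].get k := fun k => by
    rw [hf k]
    simp [labels, g]
    rfl
  have hlt : ∀ k l, k < l → g k < g l := fun k l hkl => f.strictMono hkl
  refine h ⟨g 0, g 1, g 2, g 3, hlt _ _ (by decide), hlt _ _ (by decide), hlt _ _ (by decide),
    ?_, ?_, ?_⟩
  · rw [← blockIndex_eq_iff, hg, hg]; rfl
  · rw [← blockIndex_eq_iff, hg, hg]; rfl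
  · rw [← blockIndex_eq_iff, hg, hg]; exact hab

theorem mem_or_mem_of_labels_eq {n : ℕ} {τ : Setoid (Fin n)} (h : ∀ j, ∃ k, τ j k ∧ k ≠ j)
    {A B : List ℕ} {l : ℕ} (ht : labels τ = A ++ l :: B) : l ∈ A ∨ l ∈ B := by
  have hn : n = A.length + (B.length + 1) := by simpa using congrArg List.length ht
  obtain ⟨k, hk, hne⟩ := h ⟨A.length, by omega⟩
  have key : ∀ j : Fin n, (A ++ l :: B)[(j : ℕ)]? = some (blockIndex τ j) := fun j => by
    rw [← ht]
    simp [labels]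
  have h1 : blockIndex τ ⟨A.length, by omega⟩ = l := by
    have := key ⟨A.length, by omega⟩
    simpa using this.symm
  have h2 := key k
  rw [← (blockIndex_eq_iff τ).2 hk, h1] at h2
  rcases lt_trichotomy (k : ℕ) A.length with hlt | heq | hgt
  · rw [List.getElem?_append_left hlt] at h2
    exact Or.inl (List.mem_of_getElem? h2)
  · exact absurd (Fin.ext heq) hne
  · rw [List.getElem?_append_right hgt.le] at h2
    obtain ⟨m, hm⟩ : ∃ m, (k : ℕ) - A.length = m + 1 := ⟨k - A.length - 1, by omega⟩
    rw [hm, List.getElem?_cons_succ] at h2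
    exact Or.inr (List.mem_of_getElem? h2)

end SetPartition

namespace ExchangeabilitySystem

variable {A : Type*} [NormedRing A] [StarRing A] [CStarRing A] [NormedAlgebra ℂ A]
  [StarModule ℂ A] {φ : A →ₗ[ℂ] ℂ} {U : Type*} [CStarAlgebra U]

theorem moment_eq_of_ker_eq (E : ExchangeabilitySystem φ U) {n : ℕ} {h h' : Fin n → ℕ}
    (hk : Setoid.ker h = Setoid.ker h') (X : Fin n → A) : E.moment h X = E.moment h' X := by
  obtain ⟨σ, hσ, hσh⟩ := Setoid.exists_perm_of_ker_eq hk
  simp only [moment, E.exchangeable σ hσ n X h, hσh]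

open scoped Classical in
/-- Möbius inversion of the definition of the cumulants. -/
theorem partMoment_eq_sum_cumulant (E : ExchangeabilitySystem φ U) {n : ℕ} (π : Setoid (Fin n))
    (X : Fin n → A) : E.partMoment π X = ∑ σ : Setoid (Fin n) with σ ≤ π, E.cumulant σ X := by
  have h1 : ∑ σ : Setoid (Fin n) with σ ≤ π, E.cumulant σ X
      = ∑ ρ : Setoid (Fin n), ∑ σ ∈ Finset.Icc ρ π,
          E.partMoment ρ X * SetPartition.moebius ρ σ := by
    simp only [cumulant]
    refine Finset.sum_comm' fun σ ρ => ?_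
    simp [and_comm]
  rw [h1]
  simp only [← Finset.mul_sum, SetPartition.moebius, IncidenceAlgebra.sum_Icc_mu_right]
  simp

/-- The moment of the word `X^{(w₁)} ⋯ X^{(wₙ)}`. -/
noncomputable def wordMoment (E : ExchangeabilitySystem φ U) (X : A) (w : List ℕ) : ℂ :=
  E.state (w.map fun k => E.ι k X).prod

open scoped Classical in
theorem wordMoment_eq_sum (E : ExchangeabilitySystem φ U) (X : A) {n : ℕ} {w : List ℕ}
    (hw : w.length = n) :
    E.wordMoment X w = ∑ τ : Setoid (Fin n), E.cumulant τ (fun _ => X) *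
      (if ∃ F : ℕ → ℕ, (SetPartition.labels τ).map F = w then 1 else 0) := by
  subst hw
  have h1 : E.wordMoment X w = E.moment w.get fun _ => X := by
    rw [wordMoment, moment]
    congr 2
    conv_lhs => rw [← List.ofFn_get w]
    rw [List.map_ofFn]
    rfl
  rw [h1, E.moment_eq_of_ker_eq (SetPartition.ker_blockIndex (Setoid.ker w.get)).symm]
  change E.partMoment _ _ = _
  rw [partMoment_eq_sum_cumulant, Finset.sum_filter]
  refine Finset.sum_congr rfl fun τ _ => ?_
  simp only [SetPartition.le_ker_iff_exists_map, mul_ite, mul_one, mul_zero]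

theorem cumulant_eq_zero_of_singleton (E : ExchangeabilitySystem φ U)
    (hs : E.WeakSingletonCondition) {n : ℕ} {X : Fin n → A} {τ : Setoid (Fin n)} {j : Fin n}
    (hX : E.state (star (E.ι 1 (X j)) * E.ι 2 (X j)) = 0) (hj : ∀ k, τ j k → k = j) :
    E.cumulant τ X = 0 := by
  refine Finset.sum_eq_zero fun σ hσ => ?_
  have hσ : σ ≤ τ := by simpa using hσ
  rw [partMoment, hs n X _ j
    (fun k hk => hj k (hσ ((SetPartition.blockIndex_eq_iff σ).1 hk.symm))) hX, zero_mul]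

end ExchangeabilitySystem

/-! ### Hilbert space and state inequalities -/

/-- The operator inequality behind the norm bound. If the `p i`, `q i` are the components of `v`,
`w` in mutually orthogonal subspaces and the compression of `x i` to the complement of the `i`-th
subspace vanishes, then of the four pieces of `∑ x i` the one inside the subspaces is block
diagonal and the two mixed ones are bounded by `√N`. -/
theorem inner_sum_le_of_reducing {H ι : Type*} [DecidableEq ι]
    [SeminormedAddCommGroup H] [InnerProductSpace ℝ H]
    (s : Finset ι) (x : ι → H →ₗ[ℝ] H) {c : ℝ} (hc : 0 ≤ c) (hx : ∀ i v, ‖x i v‖ ≤ c * ‖v‖)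
    {v w : H} {p q : ι → H}
    (hp : ∀ i ∈ s, ∀ j ∈ s, inner ℝ (p i) (p j) = if i = j then inner ℝ (p i) v else 0)
    (hq : ∀ i ∈ s, ∀ j ∈ s, inner ℝ (q i) (q j) = if i = j then inner ℝ (q i) w else 0)
    (h0 : ∀ i ∈ s, inner ℝ (w - q i) (x i (v - p i)) = 0) :
    ∑ i ∈ s, inner ℝ w (x i v) ≤ (1 + 2 * √s.card) * c * (‖w‖ * ‖v‖) := by
  -- Bessel's inequality for the components
  have bessel : ∀ {v : H} {p : ι → H},
      (∀ i ∈ s, ∀ j ∈ s, inner ℝ (p i) (p j) = if i = j then inner ℝ (p i) v else 0) →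
      ∑ i ∈ s, ‖p i‖ ^ 2 ≤ ‖v‖ ^ 2 := by
    intro v p hp
    have h1 : ∀ i ∈ s, inner ℝ (p i) v = ‖p i‖ ^ 2 := fun i hi => by
      have := hp i hi i hi
      rw [if_pos rfl, real_inner_self_eq_norm_sq] at this
      exact this.symm
    have h2 : ‖∑ i ∈ s, p i‖ ^ 2 = ∑ i ∈ s, ‖p i‖ ^ 2 := by
      rw [← real_inner_self_eq_norm_sq, sum_inner]
      refine Finset.sum_congr rfl fun i hi => ?_
      rw [inner_sum, Finset.sum_congr rfl (hp i hi), Finset.sum_ite_eq, if_pos hi, h1 i hi]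
    have h3 : inner ℝ v (∑ i ∈ s, p i) = ∑ i ∈ s, ‖p i‖ ^ 2 := by
      rw [real_inner_comm, sum_inner, Finset.sum_congr rfl h1]
    have h4 := norm_sub_sq_real v (∑ i ∈ s, p i)
    have := sq_nonneg ‖v - ∑ i ∈ s, p i‖
    linarith
  have contract : ∀ {v : H} {p : ι → H},
      (∀ i ∈ s, ∀ j ∈ s, inner ℝ (p i) (p j) = if i = j then inner ℝ (p i) v else 0) →
      ∀ i ∈ s, ‖v - p i‖ ≤ ‖v‖ := by
    intro v p hp i hi
    have h1 := hp i hi i hi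
    rw [if_pos rfl, real_inner_self_eq_norm_sq, real_inner_comm] at h1
    have h2 := norm_sub_sq_real v (p i)
    refine (sq_le_sq₀ (norm_nonneg _) (norm_nonneg _)).1 ?_
    nlinarith [sq_nonneg ‖p i‖]
  have l1 : ∀ {v : H} {p : ι → H},
      (∀ i ∈ s, ∀ j ∈ s, inner ℝ (p i) (p j) = if i = j then inner ℝ (p i) v else 0) →
      ∑ i ∈ s, ‖p i‖ ≤ √s.card * ‖v‖ := by
    intro v p hp
    refine (sq_le_sq₀ (Finset.sum_nonneg fun _ _ => norm_nonneg _) (by positivity)).1 ?_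
    rw [mul_pow, Real.sq_sqrt (Nat.cast_nonneg _)]
    exact sq_sum_le_card_mul_sum_sq.trans
      (mul_le_mul_of_nonneg_left (bessel hp) (Nat.cast_nonneg _))
  have hmix : ∑ i ∈ s, ‖q i‖ * ‖p i‖ ≤ ‖w‖ * ‖v‖ := by
    refine (Real.sum_mul_le_sqrt_mul_sqrt s _ _).trans ?_
    exact mul_le_mul (Real.sqrt_le_iff.2 ⟨norm_nonneg _, bessel hq⟩)
      (Real.sqrt_le_iff.2 ⟨norm_nonneg _, bessel hp⟩) (Real.sqrt_nonneg _) (norm_nonneg _)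
  have hterm : ∀ i ∈ s, inner ℝ w (x i v)
      ≤ c * (‖q i‖ * ‖v‖ + ‖q i‖ * ‖p i‖ + ‖w‖ * ‖p i‖) := by
    intro i hi
    have e : inner ℝ w (x i v) = inner ℝ (q i) (x i (v - p i)) + inner ℝ (q i) (x i (p i))
        + inner ℝ (w - q i) (x i (p i)) := by
      have := h0 i hi
      simp only [map_sub, inner_sub_left, inner_sub_right] at this ⊢
      linarith
    have b : ∀ a y a' y' : H, ‖a‖ ≤ ‖a'‖ → ‖y‖ ≤ ‖y'‖ →
        inner ℝ a (x i y) ≤ c * (‖a'‖ * ‖y'‖) := fun a y a' y' ha hy =>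
      calc inner ℝ a (x i y) ≤ ‖a‖ * ‖x i y‖ := real_inner_le_norm _ _
        _ ≤ ‖a'‖ * (c * ‖y'‖) := mul_le_mul ha
            ((hx i y).trans (mul_le_mul_of_nonneg_left hy hc)) (norm_nonneg _) (norm_nonneg _)
        _ = c * (‖a'‖ * ‖y'‖) := by ring
    rw [e, mul_add, mul_add]
    exact add_le_add (add_le_add (b _ _ _ _ le_rfl (contract hp i hi)) (b _ _ _ _ le_rfl le_rfl))
      (b _ _ _ _ (contract hq i hi) le_rfl)
  refine (Finset.sum_le_sum hterm).trans ?_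
  rw [← Finset.mul_sum, Finset.sum_add_distrib, Finset.sum_add_distrib, ← Finset.sum_mul,
    ← Finset.mul_sum]
  calc c * ((∑ i ∈ s, ‖q i‖) * ‖v‖ + ∑ i ∈ s, ‖q i‖ * ‖p i‖ + ‖w‖ * ∑ i ∈ s, ‖p i‖)
      ≤ c * ((√s.card * ‖w‖) * ‖v‖ + ‖w‖ * ‖v‖ + ‖w‖ * (√s.card * ‖v‖)) := by
        gcongr
        · exact l1 hq
        · exact l1 hp
    _ = (1 + 2 * √s.card) * c * (‖w‖ * ‖v‖) := by ring

theorem one_add_two_mul_sqrt_le {N : ℕ} (hN : 2 ≤ N) :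
    1 + 2 * √(N : ℝ) ≤ 2 * √(N : ℝ) / (1 - 1 / √(N : ℝ)) := by
  have h1 : 1 < √(N : ℝ) := by
    rw [Real.lt_sqrt zero_le_one]
    norm_cast
  have h2 : 0 < 1 - 1 / √(N : ℝ) := by
    rw [sub_pos, div_lt_one (by linarith)]
    exact h1
  rw [le_div_iff₀ h2]
  have h3 : √(N : ℝ) * (1 / √(N : ℝ)) = 1 := mul_one_div_cancel (by linarith)
  have h4 : 0 ≤ 1 / √(N : ℝ) := by positivity
  nlinarith

section State

variable {U : Type*} [CStarAlgebra U] {f : U →ₗ[ℂ] ℂ}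

attribute [local instance] CStarAlgebra.spectralOrder CStarAlgebra.spectralOrderedRing

theorem IsState.nonneg (hf : IsState f) {T : U} (hT : 0 ≤ T) : 0 ≤ (f T).re := by
  obtain ⟨S, rfl⟩ := CStarAlgebra.nonneg_iff_eq_star_mul_self.1 hT
  exact hf.re_nonneg S

theorem IsState.re_mono (hf : IsState f) {S T : U} (h : S ≤ T) : (f S).re ≤ (f T).re := by
  have := hf.nonneg (sub_nonneg.2 h)
  rwa [map_sub, Complex.sub_re, sub_nonneg] at this

theorem IsState.re_star_mul_comm (hf : IsState f) (S T : U) :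
    (f (star S * T)).re = (f (star T * S)).re := by
  -- polarization: the value at `(S + iT)* (S + iT)` is real
  have h := hf.im_eq_zero (S + Complex.I • T)
  have h1 := hf.im_eq_zero S
  have h2 := hf.im_eq_zero T
  simp only [star_add, star_smul, add_mul, mul_add, map_add, smul_mul_assoc, mul_smul_comm,
    map_smul, Complex.add_im] at h
  simp at h
  linarith

theorem IsState.re_star_mul_mul_self_le (hf : IsState f) (a T : U) :
    (f (star (a * T) * (a * T))).re ≤ ‖a‖ ^ 2 * (f (star T * T)).re := by
  have h := hf.re_mono (star_left_conjugate_le_conjugate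
    (CStarAlgebra.star_mul_le_algebraMap_norm_sq (a := a)) T)
  rw [star_mul, mul_assoc, ← mul_assoc (star a), ← mul_assoc]
  refine h.trans_eq ?_
  rw [Algebra.algebraMap_eq_smul_one, mul_smul_comm, mul_one, smul_mul_assoc,
    LinearMap.map_smul_of_tower, Complex.real_smul, Complex.re_ofReal_mul]

/-- A faithful state recovers the norm of a selfadjoint element from the growth of its even
moments. -/
theorem IsState.norm_le_of_moments (hf : IsState f) (hfaith : ∀ T : U, f (star T * T) = 0 → T = 0)
    {S : U} (hS : IsSelfAdjoint S) {C : ℝ} (hC : 0 ≤ C)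
    (h : ∀ n : ℕ, (f (star (S ^ n) * S ^ n)).re ≤ (C ^ n) ^ 2) : ‖S‖ ≤ C := by
  have : Nontrivial U := ⟨⟨0, 1, fun h => by simpa [← h] using hf.map_one⟩⟩
  by_contra! hlt
  obtain ⟨D, hCD, hD⟩ := exists_between hlt
  have hD0 : 0 < D := hC.trans_lt hCD
  -- a nonzero positive element `g(S)` living on the part of the spectrum with `|x| > D > C`, where
  -- `g(x)` is dominated by every `‖S‖ (x / D)²ⁿ`
  let g : ℝ → ℝ := fun x => max (|x| - D) 0
  have hg : Continuous g := by fun_prop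
  have hg0 : 0 ≤ cfc g S := cfc_nonneg fun x _ => le_max_right _ _
  have hne : cfc g S ≠ 0 := by
    intro h0
    have hspec : spectrum ℝ (cfc g S) = g '' spectrum ℝ S := cfc_map_spectrum g S hS hg.continuousOn
    have hgS : g ‖S‖ ∈ spectrum ℝ (cfc g S) ∧ 0 < g ‖S‖ := by
      refine ⟨?_, lt_max_of_lt_left (by rw [abs_of_nonneg (norm_nonneg S)]; linarith)⟩
      rw [hspec]
      rcases CStarAlgebra.norm_or_neg_norm_mem_spectrum hS with h | h
      · exact ⟨_, h, rfl⟩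
      · exact ⟨_, h, by simp [g]⟩
    rw [h0, spectrum.zero_eq] at hgS
    exact hgS.2.ne' hgS.1
  have hpos : 0 < (f (cfc g S)).re := by
    refine lt_of_le_of_ne (hf.nonneg hg0) fun h0 => hne ?_
    obtain ⟨T, hT⟩ := CStarAlgebra.nonneg_iff_eq_star_mul_self.1 hg0
    rw [hT] at h0 ⊢
    rw [hfaith T (Complex.ext h0.symm (hf.im_eq_zero T)), mul_zero]
  have hbound : ∀ n : ℕ, (f (cfc g S)).re ≤ ‖S‖ * ((C / D) ^ 2) ^ n := by
    intro n
    have hle : cfc g S ≤ cfc (fun x : ℝ => (‖S‖ / D ^ (2 * n)) * x ^ (2 * n)) S := by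
      refine cfc_mono fun x hx => ?_
      have hx' : |x| ≤ ‖S‖ := by simpa using spectrum.norm_le_norm_of_mem hx
      have e : ‖S‖ / D ^ (2 * n) * x ^ (2 * n) = ‖S‖ * ((|x| / D) ^ (2 * n)) := by
        rw [div_pow, (even_two_mul n).pow_abs]
        ring
      change max (|x| - D) 0 ≤ ‖S‖ / D ^ (2 * n) * x ^ (2 * n)
      rw [e]
      refine max_le ?_ (by positivity)
      rcases le_total |x| D with hxD | hxD
      · exact (sub_nonpos.2 hxD).trans (by positivity)
      · have : 1 ≤ (|x| / D) ^ (2 * n) := one_le_pow₀ ((one_le_div hD0).2 hxD)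
        nlinarith [norm_nonneg S]
    have := hf.re_mono hle
    rw [cfc_const_mul (‖S‖ / D ^ (2 * n)) (fun x : ℝ => x ^ (2 * n)) S, cfc_pow_id S,
      LinearMap.map_smul_of_tower, Complex.real_smul, Complex.re_ofReal_mul] at this
    refine this.trans ?_
    have h2 := h n
    rw [star_pow, hS.star_eq, ← pow_add, ← two_mul] at h2
    calc ‖S‖ / D ^ (2 * n) * (f (S ^ (2 * n))).re ≤ ‖S‖ / D ^ (2 * n) * (C ^ n) ^ 2 := by gcongr
      _ = ‖S‖ * ((C / D) ^ 2) ^ n := by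
        rw [div_pow, div_pow, ← pow_mul, ← pow_mul, ← pow_mul, mul_comm n 2]
        ring
  have hlim : Filter.Tendsto (fun n : ℕ => ‖S‖ * ((C / D) ^ 2) ^ n) Filter.atTop
      (nhds (‖S‖ * 0)) := by
    refine (tendsto_pow_atTop_nhds_zero_of_lt_one (by positivity) ?_).const_mul _
    have : C / D < 1 := (div_lt_one hD0).2 hCD
    have : 0 ≤ C / D := by positivity
    nlinarith
  rw [mul_zero] at hlim
  exact absurd (ge_of_tendsto' hlim hbound) (not_le.2 hpos)

end State

/-! ### The inner product on words -/

namespace NoncrossingWords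

/-- The `k`-th way of turning letters into indices of the exchangeability system: named letters get
the same index for all `k`, dummies get different indices for different `k`. -/
def copy (k : ℕ) (p : ℕ × ℕ) : ℕ := Nat.pair (if p.1 = 0 then 0 else k) (Nat.pair p.1 p.2)

theorem copy_eq_copy_iff {k l : ℕ} {p q : ℕ × ℕ} :
    copy k p = copy l q ↔ p = q ∧ (p.1 = 0 ∨ k = l) := by
  obtain ⟨a, b⟩ := p
  obtain ⟨c, d⟩ := q
  simp only [copy, Nat.pair_eq_pair, Prod.mk.injEq]
  grind

theorem copy_injective (k : ℕ) : Function.Injective (copy k) := fun _ _ h =>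
  (copy_eq_copy_iff.1 h).1

theorem copy_named (k i : ℕ) : copy k (0, i) = copy 0 (0, i) := rfl

theorem exists_map_eq_iff_compat {k l : ℕ} (hkl : k ≠ l) {tl tr : List ℕ} {u v : List (ℕ × ℕ)}
    (hu : tl.length = u.length) :
    (∃ F : ℕ → ℕ, (tl.reverse ++ tr).map F = (u.map (copy k)).reverse ++ v.map (copy l)) ↔
      Compat tl u tr v := by
  classical
  constructor
  · rintro ⟨F, hF⟩
    rw [List.map_append, List.map_reverse] at hF
    obtain ⟨h1, h2⟩ := List.append_inj hF (by simp [hu])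
    have h1 := List.reverse_injective h1
    have e1 : tl.map (Function.invFun (copy k) ∘ F) = u := by
      rw [← List.map_map, h1, List.map_map, Function.invFun_comp (copy_injective k), List.map_id]
    have e2 : tr.map (Function.invFun (copy l) ∘ F) = v := by
      rw [← List.map_map, h2, List.map_map, Function.invFun_comp (copy_injective l), List.map_id]
    refine ⟨_, _, e1, e2, fun m hm hm' => ?_⟩
    have m1 : F m ∈ u.map (copy k) := h1 ▸ List.mem_map_of_mem hm
    have m2 : F m ∈ v.map (copy l) := h2 ▸ List.mem_map_of_mem hm'
    obtain ⟨p, -, hp⟩ := List.mem_map.1 m1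
    obtain ⟨q, -, hq⟩ := List.mem_map.1 m2
    obtain ⟨rfl, h⟩ := copy_eq_copy_iff.1 (hp.trans hq.symm)
    have h := h.resolve_right hkl
    have e1 : (Function.invFun (copy k) ∘ F) m = p := by
      rw [Function.comp_apply, ← hp]
      exact Function.leftInverse_invFun (copy_injective k) p
    have e2 : (Function.invFun (copy l) ∘ F) m = p := by
      rw [Function.comp_apply, ← hq]
      exact Function.leftInverse_invFun (copy_injective l) p
    exact ⟨e1.trans e2.symm, e1 ▸ h⟩
  · rintro ⟨f, g, rfl, rfl, h⟩
    refine ⟨fun m => if m ∈ tl then copy k (f m) else copy l (g m), ?_⟩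
    rw [List.map_append, List.map_reverse, List.map_map, List.map_map]
    congr 1
    · congr 1
      exact List.map_congr_left fun m hm => if_pos hm
    · refine List.map_congr_left fun m hm => ?_
      split_ifs with h'
      · obtain ⟨h1, h2⟩ := h m h' hm
        exact copy_eq_copy_iff.2 ⟨h1, Or.inl h2⟩
      · rfl

end NoncrossingWords

namespace ExchangeabilitySystem

open NoncrossingWords SetPartition Finsupp

variable {A : Type*} [NormedRing A] [StarRing A] [CStarRing A] [NormedAlgebra ℂ A]
  [StarModule ℂ A] {φ : A →ₗ[ℂ] ℂ} {U : Type*} [CStarAlgebra U]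

open scoped Classical in
/-- Moments depend only on the kernel of the word. -/
theorem wordMoment_map_injective (E : ExchangeabilitySystem φ U) (X : A) {α : Type*} [Nonempty α]
    {s s' : α → ℕ} (hs : Function.Injective s) (hs' : Function.Injective s') (w : List α) :
    E.wordMoment X (w.map s) = E.wordMoment X (w.map s') := by
  rw [E.wordMoment_eq_sum X (List.length_map _), E.wordMoment_eq_sum X (List.length_map _)]
  refine Finset.sum_congr rfl fun τ _ => ?_
  have key : ∀ {s s' : α → ℕ}, Function.Injective s →
      (∃ F : ℕ → ℕ, (labels τ).map F = w.map s) → ∃ F : ℕ → ℕ, (labels τ).map F = w.map s' := by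
    rintro s s' hs ⟨F, hF⟩
    refine ⟨(s' ∘ Function.invFun s) ∘ F, ?_⟩
    rw [← List.map_map, hF, List.map_map, Function.comp_assoc, Function.invFun_comp hs,
      Function.comp_id]
  congr 1
  exact if_congr ⟨key hs, key hs'⟩ rfl rfl

/-- Evaluation of words in `U`, with the indices chosen by `copy k`. -/
noncomputable def eval (E : ExchangeabilitySystem φ U) (X : A) (k : ℕ) : WordSpace →ₗ[ℝ] U :=
  linearCombination ℝ fun w => ((w.map (copy k)).map fun n => E.ι n X).prod

/-- The form `(x, y) ↦ Re φ(x* y)`, where `x` is evaluated by the `k`-th and `y` by the `l`-th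
choice of indices. For `k ≠ l` it does not depend on them, and is then the inner product of the
argument. -/
noncomputable def pairing (E : ExchangeabilitySystem φ U) (X : A) (k l : ℕ) :
    WordSpace →ₗ[ℝ] WordSpace →ₗ[ℝ] ℝ :=
  LinearMap.mk₂ ℝ (fun x y => (E.state (star (E.eval X k x) * E.eval X l y)).re)
    (fun x x' y => by simp [add_mul])
    (fun c x y => by simp [LinearMap.map_smul_of_tower])
    (fun x y y' => by simp [mul_add])
    (fun c x y => by simp [LinearMap.map_smul_of_tower])

theorem pairing_apply (E : ExchangeabilitySystem φ U) (X : A) (k l : ℕ) (x y : WordSpace) :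
    E.pairing X k l x y = (E.state (star (E.eval X k x) * E.eval X l y)).re := rfl

theorem star_prod_map_ι (E : ExchangeabilitySystem φ U) {X : A} (hX : IsSelfAdjoint X)
    (w : List ℕ) : star (w.map fun n => E.ι n X).prod = (w.reverse.map fun n => E.ι n X).prod := by
  induction w with
  | nil => simp
  | cons n w ih => simp [ih, ← map_star, hX.star_eq]

theorem pairing_single (E : ExchangeabilitySystem φ U) {X : A} (hX : IsSelfAdjoint X) (k l : ℕ)
    (u v : List (ℕ × ℕ)) :
    E.pairing X k l (single u 1) (single v 1)
      = (E.wordMoment X ((u.map (copy k)).reverse ++ v.map (copy l))).re := by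
  rw [pairing_apply, eval, eval, linearCombination_single, linearCombination_single, one_smul,
    one_smul, E.star_prod_map_ι hX, wordMoment, List.map_append, List.prod_append]

theorem pairing_single_eq_sum (E : ExchangeabilitySystem φ U) {X : A} (hX : IsSelfAdjoint X)
    {k l : ℕ} (hkl : k ≠ l) {m n : ℕ} {u v : List (ℕ × ℕ)} (hu : u.length = m)
    (hv : v.length = n) :
    E.pairing X k l (single u 1) (single v 1) = ∑ τ : Setoid (Fin (m + n)),
      (E.cumulant τ fun _ => X).re *
        compatForm ((labels τ).take m).reverse ((labels τ).drop m) (single u 1) (single v 1) := by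
  classical
  rw [E.pairing_single hX, E.wordMoment_eq_sum X (n := m + n) (by simp [hu, hv]), Complex.re_sum]
  refine Finset.sum_congr rfl fun τ _ => ?_
  have := exists_map_eq_iff_compat hkl (tl := ((labels τ).take m).reverse)
    (tr := (labels τ).drop m) (u := u) (v := v) (by simp [hu])
  rw [List.reverse_reverse, List.take_append_drop] at this
  simp only [compatForm_single, compatInd, this]
  split_ifs <;> simp

theorem pairing_eq_pairing (E : ExchangeabilitySystem φ U) {X : A} (hX : IsSelfAdjoint X)
    {k l : ℕ} (hkl : k ≠ l) : E.pairing X k l = E.pairing X 0 1 :=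
  bilin_ext fun u v => by
    rw [E.pairing_single_eq_sum hX hkl rfl rfl, E.pairing_single_eq_sum hX zero_ne_one rfl rfl]

theorem pairing_self_eq (E : ExchangeabilitySystem φ U) {X : A} (hX : IsSelfAdjoint X) (k : ℕ) :
    E.pairing X k k = E.pairing X 0 0 :=
  bilin_ext fun u v => by
    rw [E.pairing_single hX, E.pairing_single hX, ← List.map_reverse, ← List.map_reverse,
      ← List.map_append, ← List.map_append,
      E.wordMoment_map_injective X (copy_injective k) (copy_injective 0)]

theorem pairing_eq_sum (E : ExchangeabilitySystem φ U) {X : A} (hX : IsSelfAdjoint X) {m n : ℕ}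
    {x y : WordSpace} (hx : x ∈ supported ℝ ℝ {w : List (ℕ × ℕ) | w.length = m})
    (hy : y ∈ supported ℝ ℝ {w : List (ℕ × ℕ) | w.length = n}) :
    E.pairing X 0 1 x y = ∑ τ : Setoid (Fin (m + n)), (E.cumulant τ fun _ => X).re *
        compatForm ((labels τ).take m).reverse ((labels τ).drop m) x y := by
  have := bilin_eqOn_supported (B := E.pairing X 0 1)
    (B' := ∑ τ : Setoid (Fin (m + n)), (E.cumulant τ fun _ => X).re •
        compatForm ((labels τ).take m).reverse ((labels τ).drop m))
    (s := {w : List (ℕ × ℕ) | w.length = m}) (t := {w : List (ℕ × ℕ) | w.length = n})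
    (fun u hu v hv => by
      rw [E.pairing_single_eq_sum hX zero_ne_one hu hv]
      simp [LinearMap.sum_apply]) hx hy
  rw [this]
  simp [LinearMap.sum_apply]

/-- Two values of the inner product agree if the contributions of all noncrossing partitions
without singletons agree. -/
theorem pairing_congr (E : ExchangeabilitySystem φ U) (hnoncrossing : E.IsNoncrossing)
    (hsingleton : E.WeakSingletonCondition) {X : A} (hX : IsSelfAdjoint X)
    (hX12 : E.state (E.ι 1 X * E.ι 2 X) = 0) {m n : ℕ} {x y x' y' : WordSpace}
    (hx : x ∈ supported ℝ ℝ {w : List (ℕ × ℕ) | w.length = m})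
    (hy : y ∈ supported ℝ ℝ {w : List (ℕ × ℕ) | w.length = n})
    (hx' : x' ∈ supported ℝ ℝ {w : List (ℕ × ℕ) | w.length = m})
    (hy' : y' ∈ supported ℝ ℝ {w : List (ℕ × ℕ) | w.length = n})
    (h : ∀ tl tr : List ℕ, tl.length = m → tr.length = n → IsNC (tl.reverse ++ tr) →
      (∀ (B C : List ℕ) (l : ℕ), tl.reverse ++ tr = B ++ l :: C → l ∈ B ∨ l ∈ C) →
      compatForm tl tr x y = compatForm tl tr x' y') :
    E.pairing X 0 1 x y = E.pairing X 0 1 x' y' := by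
  rw [E.pairing_eq_sum hX hx hy, E.pairing_eq_sum hX hx' hy']
  refine Finset.sum_congr rfl fun τ _ => ?_
  by_cases hnc : SetPartition.IsNoncrossing τ
  swap
  · rw [hnoncrossing _ τ hnc]
    simp
  by_cases hsg : ∀ j, ∃ k, τ j k ∧ k ≠ j
  swap
  · push Not at hsg
    obtain ⟨j, hj⟩ := hsg
    rw [E.cumulant_eq_zero_of_singleton hsingleton (j := j) _ hj]
    · simp
    · rwa [← map_star, hX.star_eq]
  have e : ((labels τ).take m).reverse.reverse ++ (labels τ).drop m = labels τ := by
    rw [List.reverse_reverse, List.take_append_drop]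
  rw [h _ _ (by simp) (by simp) (by rw [e]; exact hnc.isNC_labels) fun B C l hl =>
    mem_or_mem_of_labels_eq hsg (e.symm.trans hl)]

theorem pairing_comm (E : ExchangeabilitySystem φ U) {X : A} (hX : IsSelfAdjoint X)
    (x y : WordSpace) : E.pairing X 0 1 x y = E.pairing X 0 1 y x := by
  rw [pairing_apply, E.isState.re_star_mul_comm, ← pairing_apply,
    E.pairing_eq_pairing hX one_ne_zero]

theorem nonneg_of_forall_nat {q c : ℝ} (h : ∀ M : ℕ, 0 ≤ (M * M - M) * q + M * c) : 0 ≤ q := by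
  by_contra! hq
  obtain ⟨M, hM⟩ := exists_nat_gt (1 + |c| / -q)
  have hM1 : (1 : ℝ) < M := lt_of_le_of_lt (by
    have : 0 ≤ |c| / -q := div_nonneg (abs_nonneg _) (by linarith)
    linarith) hM
  have h1 : |c| < (M - 1) * -q := by
    rw [← div_lt_iff₀ (by linarith)]
    linarith
  have h2 := h M
  have h3 := le_abs_self c
  nlinarith

/-- For a sum of `M` independent copies of a vector, the inner product is the leading coefficient
of the square as a polynomial in `M`; this is the source of positivity and of the operator bounds.
-/
theorem re_state_star_sum_eval (E : ExchangeabilitySystem φ U) {X : A} (hX : IsSelfAdjoint X)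
    (M : ℕ) (x : WordSpace) :
    (E.state (star (∑ k ∈ Finset.range M, E.eval X k x) * ∑ k ∈ Finset.range M, E.eval X k x)).re
      = (M * M - M) * E.pairing X 0 1 x x + M * E.pairing X 0 0 x x := by
  rw [star_sum, Finset.sum_mul_sum, map_sum, Complex.re_sum]
  have : ∀ k ∈ Finset.range M,
      (E.state (∑ l ∈ Finset.range M, star (E.eval X k x) * E.eval X l x)).re
        = M * E.pairing X 0 1 x x + (E.pairing X 0 0 x x - E.pairing X 0 1 x x) := by
    intro k hk
    rw [map_sum, Complex.re_sum]
    have : ∀ l ∈ Finset.range M, (E.state (star (E.eval X k x) * E.eval X l x)).re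
        = E.pairing X 0 1 x x
          + if k = l then E.pairing X 0 0 x x - E.pairing X 0 1 x x else 0 := by
      intro l _
      rw [← pairing_apply]
      split_ifs with h
      · rw [← h, E.pairing_self_eq hX]
        ring
      · rw [E.pairing_eq_pairing hX h, add_zero]
    rw [Finset.sum_congr rfl this, Finset.sum_add_distrib, Finset.sum_ite_eq, if_pos hk]
    simp
  rw [Finset.sum_congr rfl this, Finset.sum_const, Finset.card_range, nsmul_eq_mul]
  ring

theorem pairing_nonneg (E : ExchangeabilitySystem φ U) {X : A} (hX : IsSelfAdjoint X)
    (x : WordSpace) : 0 ≤ E.pairing X 0 1 x x :=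
  nonneg_of_forall_nat fun M => by
    rw [← E.re_state_star_sum_eval hX]
    exact E.isState.re_nonneg _

theorem eval_consMap (E : ExchangeabilitySystem φ U) (X : A) (k i : ℕ) (x : WordSpace) :
    E.eval X k (consMap i x) = E.ι (copy 0 (0, i)) X * E.eval X k x := by
  have : (E.eval X k).comp (consMap i)
      = (LinearMap.mulLeft ℝ (E.ι (copy 0 (0, i)) X)).comp (E.eval X k) := by
    refine Finsupp.lhom_ext' fun u => LinearMap.ext_ring ?_
    simp [eval, consMap, mapDomain_single, copy_named]
  exact congrArg (fun f => f x) this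

theorem pairing_consMap_le (E : ExchangeabilitySystem φ U) {X : A} (hX : IsSelfAdjoint X)
    (i : ℕ) (x : WordSpace) :
    E.pairing X 0 1 (consMap i x) (consMap i x) ≤ ‖X‖ ^ 2 * E.pairing X 0 1 x x := by
  rw [← sub_nonneg]
  refine nonneg_of_forall_nat (c := ‖X‖ ^ 2 * E.pairing X 0 0 x x
    - E.pairing X 0 0 (consMap i x) (consMap i x)) fun M => ?_
  have h := E.isState.re_star_mul_mul_self_le (E.ι (copy 0 (0, i)) X)
    (∑ k ∈ Finset.range M, E.eval X k x)
  rw [Finset.mul_sum] at h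
  simp only [← eval_consMap] at h
  rw [E.re_state_star_sum_eval hX, E.re_state_star_sum_eval hX,
    (AddMonoidHomClass.isometry_iff_norm _).1 (E.isometry_ι _)] at h
  linarith

end ExchangeabilitySystem

/-! ### The norm of the sum -/

namespace NoncrossingWords

open Finsupp

/-- The inclusion of the combinations of named words. -/
noncomputable def embed : (List ℕ →₀ ℝ) →ₗ[ℝ] WordSpace := linearCombination ℝ namedVec

/-- The linear extension of `componentVec`. -/
noncomputable def componentMap (i : ℕ) : (List ℕ →₀ ℝ) →ₗ[ℝ] WordSpace :=
  linearCombination ℝ (componentVec i)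

/-- The formal power `(∑ i ∈ s, X^{(i)})ⁿ`. -/
noncomputable def powerVec (s : Finset ℕ) : ℕ → (List ℕ →₀ ℝ)
  | 0 => single [] 1
  | n + 1 => ∑ i ∈ s, mapDomain (i :: ·) (powerVec s n)

theorem embed_mapDomain_cons (i : ℕ) (x : List ℕ →₀ ℝ) :
    embed (mapDomain (i :: ·) x) = consMap i (embed x) := by
  have : embed.comp (lmapDomain ℝ ℝ (i :: ·)) = (consMap i).comp embed := by
    refine Finsupp.lhom_ext' fun u => LinearMap.ext_ring ?_
    simp [embed, consMap, mapDomain_single, namedVec, tagged]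
  exact congrArg (fun f => f x) this

end NoncrossingWords

namespace ExchangeabilitySystem

open NoncrossingWords SetPartition Finsupp

variable {A : Type*} [NormedRing A] [StarRing A] [CStarRing A] [NormedAlgebra ℂ A]
  [StarModule ℂ A] {φ : A →ₗ[ℂ] ℂ} {U : Type*} [CStarAlgebra U]

/-- Evaluation of named words at the original embeddings `ι i`. -/
noncomputable def evalNamed (E : ExchangeabilitySystem φ U) (X : A) : (List ℕ →₀ ℝ) →ₗ[ℝ] U :=
  linearCombination ℝ fun w => (w.map fun n => E.ι n X).prod

theorem evalNamed_powerVec (E : ExchangeabilitySystem φ U) (X : A) (s : Finset ℕ) (n : ℕ) :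
    E.evalNamed X (powerVec s n) = (∑ i ∈ s, E.ι i X) ^ n := by
  induction n with
  | zero => simp [powerVec, evalNamed]
  | succ n ih =>
    have h : ∀ i x, E.evalNamed X (mapDomain (i :: ·) x) = E.ι i X * E.evalNamed X x := by
      intro i x
      have : (E.evalNamed X).comp (lmapDomain ℝ ℝ (i :: ·))
          = (LinearMap.mulLeft ℝ (E.ι i X)).comp (E.evalNamed X) := by
        refine Finsupp.lhom_ext' fun u => LinearMap.ext_ring ?_
        simp [evalNamed, mapDomain_single]
      exact congrArg (fun f => f x) this
    rw [powerVec, map_sum, pow_succ', Finset.sum_mul]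
    exact Finset.sum_congr rfl fun i _ => by rw [h, ih]

theorem pairing_embed (E : ExchangeabilitySystem φ U) {X : A} (hX : IsSelfAdjoint X)
    (x y : List ℕ →₀ ℝ) : E.pairing X 0 1 (embed x) (embed y)
      = (E.state (star (E.evalNamed X x) * E.evalNamed X y)).re := by
  let B : (List ℕ →₀ ℝ) →ₗ[ℝ] (List ℕ →₀ ℝ) →ₗ[ℝ] ℝ :=
    LinearMap.mk₂ ℝ (fun x y => (E.state (star (E.evalNamed X x) * E.evalNamed X y)).re)
      (fun x x' y => by simp [add_mul])
      (fun c x y => by simp [LinearMap.map_smul_of_tower])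
      (fun x y y' => by simp [mul_add])
      (fun c x y => by simp [LinearMap.map_smul_of_tower])
  have : (E.pairing X 0 1).compl₁₂ embed embed = B := bilin_ext fun u v => by
    have h1 : B (single u 1) (single v 1) = (E.wordMoment X (u.reverse ++ v)).re := by
      simp [B, evalNamed, wordMoment, E.star_prod_map_ι hX]
    have h2 : ((tagged 0 u).map (copy 0)).reverse ++ (tagged 0 v).map (copy 1)
        = (u.reverse ++ v).map fun i => copy 0 (0, i) := by
      simp [tagged, Function.comp_def, copy_named 1]
    have h3 : (E.pairing X 0 1).compl₁₂ embed embed (single u 1) (single v 1)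
        = E.pairing X 0 1 (single (tagged 0 u) 1) (single (tagged 0 v) 1) := by
      simp [embed, namedVec]
    rw [h1, h3, E.pairing_single hX, h2, E.wordMoment_map_injective X (s' := id) _
      Function.injective_id, List.map_id]
    exact fun i j h => by simpa using copy_injective 0 h
  exact congrArg (fun B => B x y) this

/-- Components of different colours are orthogonal, and taking a component is an orthogonal
projection. -/
theorem pairing_componentMap (E : ExchangeabilitySystem φ U) (hnoncrossing : E.IsNoncrossing)
    (hsingleton : E.WeakSingletonCondition) {X : A} (hX : IsSelfAdjoint X)
    (hX12 : E.state (E.ι 1 X * E.ι 2 X) = 0) (i j : ℕ) (x : List ℕ →₀ ℝ) :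
    E.pairing X 0 1 (componentMap i x) (componentMap j x)
      = if i = j then E.pairing X 0 1 (componentMap i x) (embed x) else 0 := by
  have : (E.pairing X 0 1).compl₁₂ (componentMap i) (componentMap j)
      = if i = j then (E.pairing X 0 1).compl₁₂ (componentMap i) embed else 0 :=
    bilin_ext fun u v => by
      have hc := E.pairing_congr hnoncrossing hsingleton hX hX12 (m := u.length) (n := v.length)
        (componentVec_mem_supported i u) (componentVec_mem_supported j v)
        (x' := if i = j then componentVec i u else 0) (y' := namedVec v)
        (by split_ifs; exacts [componentVec_mem_supported i u, Submodule.zero_mem _])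
        (namedVec_mem_supported v) (fun tl tr hl hr hnc _ => by
          rw [compatForm_componentVec_componentVec hnc hl hr]
          split_ifs with h
          · subst h
            rw [compatForm_componentVec_namedVec hnc hl hr]
          · simp)
      split_ifs at hc ⊢ <;> simpa [componentMap, embed] using hc
  have := congrArg (fun B => B x x) this
  split_ifs at this ⊢ <;> simpa using this

/-- `X^{(i)}` has no corner on the complement of the `i`-th component. -/
theorem pairing_sub_componentMap (E : ExchangeabilitySystem φ U)
    (hnoncrossing : E.IsNoncrossing)
    (hsingleton : E.WeakSingletonCondition) {X : A} (hX : IsSelfAdjoint X)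
    (hX12 : E.state (E.ι 1 X * E.ι 2 X) = 0) (i : ℕ) (x y : List ℕ →₀ ℝ) :
    E.pairing X 0 1 (embed x - componentMap i x) (consMap i (embed y - componentMap i y)) = 0 := by
  have : (E.pairing X 0 1).compl₁₂ (embed - componentMap i)
      ((consMap i).comp (embed - componentMap i)) = 0 :=
    bilin_ext fun u v => by
      have hmem : ∀ u, namedVec u - componentVec i u
          ∈ supported ℝ ℝ {w : List (ℕ × ℕ) | w.length = u.length} := fun u =>
        Submodule.sub_mem _ (namedVec_mem_supported u) (componentVec_mem_supported i u)
      have hc := E.pairing_congr hnoncrossing hsingleton hX hX12 (m := u.length)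
        (n := v.length + 1) (hmem u) (consMap_mem_supported i (hmem v))
        (x' := 0) (y' := 0) (Submodule.zero_mem _) (Submodule.zero_mem _)
        (fun tl tr hl hr hnc hsg => by
          obtain ⟨l, tr, rfl⟩ := List.exists_cons_of_length_eq_add_one hr
          rw [compatForm_sub_componentVec hnc (by simpa using hsg _ _ _ rfl) hl (by simpa using hr)]
          simp)
      simpa [componentMap, embed] using hc
  exact congrArg (fun B => B x y) this

theorem pairing_embed_powerVec_le (E : ExchangeabilitySystem φ U) (hnoncrossing : E.IsNoncrossing)
    (hsingleton : E.WeakSingletonCondition) {X : A} (hX : IsSelfAdjoint X)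
    (hX12 : E.state (E.ι 1 X * E.ι 2 X) = 0) (s : Finset ℕ) (n : ℕ) :
    E.pairing X 0 1 (embed (powerVec s n)) (embed (powerVec s n))
      ≤ (((1 + 2 * √s.card) * ‖X‖) ^ n) ^ 2 := by
  -- `WordSpace` carries the semi-inner product `pairing X 0 1` for the rest of the proof
  let core : PreInnerProductSpace.Core ℝ WordSpace :=
    { inner := fun x y => E.pairing X 0 1 x y
      conj_inner_symm := fun x y => E.pairing_comm hX y x
      re_inner_nonneg := fun x => E.pairing_nonneg hX x
      add_left := fun x y z => by simp
      smul_left := fun x y c => by simp }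
  let _ : SeminormedAddCommGroup WordSpace :=
    InnerProductSpace.Core.toSeminormedAddCommGroup (c := core)
  let _ : InnerProductSpace ℝ WordSpace := InnerProductSpace.ofCore core
  have hin : ∀ x y : WordSpace, inner ℝ x y = E.pairing X 0 1 x y := fun _ _ => rfl
  have hsq : ∀ x : WordSpace, E.pairing X 0 1 x x = ‖x‖ ^ 2 := fun x => by
    rw [← real_inner_self_eq_norm_sq, hin]
  have hcons : ∀ i (x : WordSpace), ‖consMap i x‖ ≤ ‖X‖ * ‖x‖ := fun i x => by
    rw [← sq_le_sq₀ (norm_nonneg _) (by positivity), mul_pow, ← hsq, ← hsq]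
    exact E.pairing_consMap_le hX i x
  have hbes : ∀ (x : List ℕ →₀ ℝ), ∀ i ∈ s, ∀ j ∈ s,
      inner ℝ (componentMap i x) (componentMap j x)
        = if i = j then inner ℝ (componentMap i x) (embed x) else 0 := fun x i _ j _ =>
    E.pairing_componentMap hnoncrossing hsingleton hX hX12 i j x
  have hstep : ∀ n, ‖embed (powerVec s (n + 1))‖
      ≤ (1 + 2 * √s.card) * ‖X‖ * ‖embed (powerVec s n)‖ := by
    intro n
    have h := inner_sum_le_of_reducing s consMap (norm_nonneg X) hcons
      (v := embed (powerVec s n)) (w := embed (powerVec s (n + 1)))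
      (p := fun i => componentMap i (powerVec s n))
      (q := fun i => componentMap i (powerVec s (n + 1)))
      (by simpa using hbes _) (by simpa using hbes _)
      (fun i _ => E.pairing_sub_componentMap hnoncrossing hsingleton hX hX12 i _ _)
    have e : embed (powerVec s (n + 1)) = ∑ i ∈ s, consMap i (embed (powerVec s n)) := by
      simp only [powerVec, map_sum, embed_mapDomain_cons]
    rw [← inner_sum, ← e, real_inner_self_eq_norm_sq] at h
    rcases (norm_nonneg (embed (powerVec s (n + 1)))).eq_or_lt with h0 | h0
    · rw [← h0]
      positivity
    · exact le_of_mul_le_mul_left (by linarith) h0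
  rw [hsq]
  refine pow_le_pow_left₀ (norm_nonneg _) ?_ 2
  induction n with
  | zero =>
    have h1 : ‖embed (powerVec s 0)‖ ^ 2 = 1 := by
      rw [← hsq, E.pairing_embed hX, E.evalNamed_powerVec]
      simp [E.isState.map_one]
    rw [pow_zero]
    nlinarith [norm_nonneg (embed (powerVec s 0))]
  | succ n ih =>
    refine (hstep n).trans ?_
    rw [pow_succ']
    gcongr

end ExchangeabilitySystem

theorem mainTheorem2 {A : Type*} [NormedRing A] [StarRing A] [CStarRing A] [NormedAlgebra ℂ A]
    [StarModule ℂ A] {U : Type*} [CStarAlgebra U] {φ : A →ₗ[ℂ] ℂ}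
    (E : ExchangeabilitySystem φ U) (hnoncrossing : E.IsNoncrossing)
    (hsingleton : E.WeakSingletonCondition) (hfaithful : E.IsFaithful)
    (X : A) (hX : IsSelfAdjoint X) (hX12 : E.state (E.ι 1 X * E.ι 2 X) = 0)
    (N : ℕ) (hN : 2 ≤ N) :
    ‖∑ i ∈ Finset.Icc 1 N, E.ι i X‖
      ≤ 2 * Real.sqrt (N : ℝ) / (1 - 1 / Real.sqrt (N : ℝ)) * ‖X‖ := by
  have hS : IsSelfAdjoint (∑ i ∈ Finset.Icc 1 N, E.ι i X) := by
    rw [IsSelfAdjoint, star_sum]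
    exact Finset.sum_congr rfl fun i _ => by rw [← map_star, hX.star_eq]
  refine le_trans (E.isState.norm_le_of_moments hfaithful hS
    (C := (1 + 2 * √(N : ℝ)) * ‖X‖) (by positivity) fun n => ?_)
    (mul_le_mul_of_nonneg_right (one_add_two_mul_sqrt_le hN) (norm_nonneg X))
  have := E.pairing_embed_powerVec_le hnoncrossing hsingleton hX hX12 (Finset.Icc 1 N) n
  rw [E.pairing_embed hX, E.evalNamed_powerVec] at this
  simpa using this
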